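/- **Proposition 4.7.** Identify the algebra of complexified quaternions $\mathbb H_{\mathbb C}=\mathbb C\otimes_{\mathbb R}\mathbb H$ with the algebra of complex $2\times 2$ matrices $Z=\begin{pmatrix} z_{11}&z_{12}\\ z_{21}&z_{22}\end{pmatrix}=z^0e_0+z^1e_1+z^2e_2+z^3e_3$, where $e_0,\dots,e_3$ are the quaternionic units, and let $N(Z)=\det Z=\sum_k (z^k)^2$. Let $\mathbb S$ (respectively $\mathbb S'$) be the space of columns (respectively rows) of two complex numbers, and put $$\nabla=e_0\tfrac{\partial}{\partial z^0}-e_1\tfrac{\partial}{\partial z^1}-e_2\tfrac{\partial}{\partial z^2}-e_3\tfrac{\partial}{\partial z^3},\qquad \square=\sum_{k=0}^3\Bigl(\tfrac{\partial}{\partial z^k}\Bigr)^2 .$$ Consider the spaces of quasi left and right anti regular functions $$\mathcal U=\{f\in\mathbb C[z^0,z^1,z^2,z^3,N(Z)^{-1}]\otimes\mathbb S:\ \nabla\square f=0\},\qquad \mathcal U'=\{g\in\mathbb C[z^0,z^1,z^2,z^3,N(Z)^{-1}]\otimes\mathbb S':\ (\square g)\overleftarrow{\nabla}=0\},$$ where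 $\overleftarrow{\nabla}$ is $\nabla$ acting on rows from the right. For $d\in\mathbb Z$ let $\mathcal U(d)$, $\mathcal U'(d)$ be the subspaces of elements homogeneous of degree $d$, and let $$\mathcal U^+=\bigoplus_{d\ge 0}\mathcal U(d),\quad \mathcal U^-=\bigoplus_{d<0}\mathcal U(d),\quad \mathcal U'^+=\bigoplus_{d\ge 0}\mathcal U'(d),\quad \mathcal U'^-=\bigoplus_{d<0}\mathcal U'(d).$$ Let $\mathfrak{gl}(2,\mathbb H_{\mathbb C})$ be the complex Lie algebra of $2\times2$ matrices over $\mathbb H_{\mathbb C}$, and $\mathfrak{sl}(2,\mathbb H_{\mathbb C})=\bigl\{\begin{pmatrix}A&B\\C&D\end{pmatrix}:\operatorname{tr}A+\operatorname{tr}D=0\bigr\}$. Differentiating the actions of $GL(2,\mathbb H_{\mathbb C})$ $$(\pi'_l(h)f)(Z)=\frac{a'-Zc'}{N(a'-Zc')}\,f\bigl((a'-Zc')^{-1}(-b'+Zd')\bigr),\qquad (\pi'_r(h)g)(Z)=g\bigl((aZ+b)(cZ+d)^{-1}\bigr)\frac{cZ+d}{N(cZ+d)},$$ $h=\begin{pmatrix}a'&b'\\c'&d'\end{pmatrix}$,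 $h^{-1}=\begin{pmatrix}a&b\\c&d\end{pmatrix}$, gives the Lie algebra actions of $X=\begin{pmatrix}A&B\\C&D\end{pmatrix}\in\mathfrak{gl}(2,\mathbb H_{\mathbb C})$ $$\pi'_l(X)f=\operatorname{tr}(W\partial)f+\bigl(-\operatorname{tr}(A)+A+\operatorname{tr}(ZC)-ZC\bigr)f,\qquad \pi'_r(X)g=\operatorname{tr}(W\partial)g+g\bigl(\operatorname{tr}(CZ)-CZ+\operatorname{tr}(D)-D\bigr),$$ where $W=-AZ-B+ZCZ+ZD$ and $\operatorname{tr}(W\partial)=\sum_{i,j}W_{ij}\,\partial/\partial z_{ij}$. Then $(\pi'_l,\mathcal U^+)$, $(\pi'_l,\mathcal U^-)$, $(\pi'_r,\mathcal U'^+)$ and $(\pi'_r,\mathcal U'^-)$ are irreducible representations of $\mathfrak{sl}(2,\mathbb H_{\mathbb C})$, and also of $\mathfrak{gl}(2,\mathbb H_{\mathbb C})$; that is, each of the four spaces is nonzero, invariant under the action, and has no invariant subspaces other than $0$ and itself. -/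

import Mathlib

attribute [local instance] LieRing.ofAssociativeRing
attribute [local instance] LieAlgebra.ofAssociativeAlgebra

namespace QuasiRegular

noncomputable section

/-! ### Complexified quaternions and the Lie algebras `gl(2, HC)`, `sl(2, HC)` -/

/-- The algebra of complexified quaternions, identified with the complex `2 × 2` matrices. -/
abbrev HC : Type := Matrix (Fin 2) (Fin 2) ℂ

/-- The quaternionic units `e₀, e₁, e₂, e₃` as elements of `HC`. -/
def e : Fin 4 → HC :=
  ![!![1, 0; 0, 1],
    !![0, -Complex.I; -Complex.I, 0],
    !![0, -1; 1, 0],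
    !![-Complex.I, 0; 0, Complex.I]]

/-- `gl(2, HC)`: the `2 × 2` matrices with entries in `HC`, with the commutator bracket. -/
abbrev GLHC : Type := Matrix (Fin 2) (Fin 2) HC

/-- `sl(2, HC)`: the elements of `gl(2, HC)` with vanishing (complex) trace; under
`gl(2, HC) ≃ gl(4, ℂ)` this is `sl(4, ℂ)`. -/
def slHC : LieSubalgebra ℂ GLHC where
  carrier := {X | (X 0 0).trace + (X 1 1).trace = 0}
  add_mem' := by
    intro X Y hX hY
    simp only [Set.mem_ofPred_eq, Matrix.add_apply, Matrix.trace_add] at *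
    linear_combination hX + hY
  zero_mem' := by simp
  smul_mem' := by
    intro c X hX
    simp only [Set.mem_ofPred_eq, Matrix.smul_apply, Matrix.trace_smul, smul_eq_mul] at *
    linear_combination c * hX
  lie_mem' := by
    intro X Y _ _
    simp only [Set.mem_ofPred_eq, Ring.lie_def, Matrix.sub_apply, Matrix.mul_apply,
      Fin.sum_univ_two, Matrix.trace_fin_two, Matrix.add_apply]
    ring

/-! ### Extension of derivations to a localization -/

section Extend

variable {P S : Type} [CommRing P] [CommRing S] [Algebra P S] [Algebra ℂ S]

/-- A derivation `D` as an algebra homomorphism `p ↦ p + ε D(p)` to the dual numbers. -/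
def dual [Algebra ℂ P] [IsScalarTower ℂ P S] (D : Derivation ℂ P S) : P →ₐ[ℂ] TrivSqZeroExt S S :=
  AlgHom.ofLinearMap
    { toFun := fun p => TrivSqZeroExt.inl (algebraMap P S p) + TrivSqZeroExt.inr (D p)
      map_add' := by intro p q; ext <;> simp
      map_smul' := by intro c p; ext <;> simp [algebraMap.coe_smul] }
    (by ext <;> simp)
    (by
      intro p q
      ext
      · simp
      · simp only [TrivSqZeroExt.snd_mul, LinearMap.coe_mk, AddHom.coe_mk, TrivSqZeroExt.snd_add,
          TrivSqZeroExt.fst_add, TrivSqZeroExt.fst_inl, TrivSqZeroExt.fst_inr,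
          TrivSqZeroExt.snd_inl, TrivSqZeroExt.snd_inr, add_zero, zero_add, Derivation.leibniz,
          op_smul_eq_smul, algebraMap_smul])

theorem fst_dual [Algebra ℂ P] [IsScalarTower ℂ P S] (D : Derivation ℂ P S) (p : P) : (dual D p).fst = algebraMap P S p := by
  simp [dual]

theorem snd_dual [Algebra ℂ P] [IsScalarTower ℂ P S] (D : Derivation ℂ P S) (p : P) : (dual D p).snd = D p := by
  simp [dual]

theorem isUnit_dual [Algebra ℂ P] [IsScalarTower ℂ P S] (x : P) [IsLocalization.Away x S] (D : Derivation ℂ P S) : IsUnit (dual D x) := by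
  rw [TrivSqZeroExt.isUnit_iff_isUnit_fst, fst_dual]
  exact IsLocalization.Away.algebraMap_isUnit x

/-- The extension `f ↦ f + ε D(f)` of `dual D` to the localization. -/
def locDual [Algebra ℂ P] [IsScalarTower ℂ P S] (x : P) [IsLocalization.Away x S] (D : Derivation ℂ P S) : S →ₐ[ℂ] TrivSqZeroExt S S :=
  IsLocalization.Away.liftAlgHom x (isUnit_dual x D)

theorem locDual_algebraMap [Algebra ℂ P] [IsScalarTower ℂ P S] (x : P) [IsLocalization.Away x S] (D : Derivation ℂ P S) (p : P) :
    locDual x D (algebraMap P S p) = dual D p := by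
  simp [locDual]

theorem fst_locDual [Algebra ℂ P] [IsScalarTower ℂ P S] (x : P) [IsLocalization.Away x S] (D : Derivation ℂ P S) (f : S) : (locDual x D f).fst = f := by
  have h : (TrivSqZeroExt.fstHom ℂ S S).comp (locDual x D) = AlgHom.id ℂ S := by
    apply IsLocalization.algHom_ext (Submonoid.powers x)
    ext p
    simp [Algebra.algHom, locDual_algebraMap, fst_dual]
  exact DFunLike.congr_fun h f

/-- The extension of a derivation from `P` to the localization `S = P[1/x]`, that is, by the
quotient rule. -/
def extend [Algebra ℂ P] [IsScalarTower ℂ P S] (x : P) [IsLocalization.Away x S] (D : Derivation ℂ P S) : Derivation ℂ S S :=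
  Derivation.mk'
    { toFun := fun f => (locDual x D f).snd
      map_add' := by intro f g; simp
      map_smul' := by intro c f; simp }
    (by intro f g; simp [fst_locDual, mul_comm])

theorem extend_algebraMap [Algebra ℂ P] [IsScalarTower ℂ P S] (x : P) [IsLocalization.Away x S] (D : Derivation ℂ P S) (p : P) :
    extend x D (algebraMap P S p) = D p := by
  change (locDual x D (algebraMap P S p)).snd = D p
  rw [locDual_algebraMap, snd_dual]

/-- Derivations of the localization are determined by their values on `P`. -/
theorem derivation_ext (x : P) [IsLocalization.Away x S] {D E : Derivation ℂ S S}
    (h : ∀ p : P, D (algebraMap P S p) = E (algebraMap P S p)) : D = E := by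
  ext f
  obtain ⟨n, p, hp⟩ := IsLocalization.Away.surj x f
  have h1 := h p
  have hu : IsUnit (algebraMap P S x ^ n) := (IsLocalization.Away.algebraMap_isUnit x).pow n
  rw [← hp, Derivation.leibniz, Derivation.leibniz, ← map_pow, h (x ^ n)] at h1
  simp only [smul_eq_mul, add_right_inj] at h1
  rw [map_pow] at h1
  exact hu.mul_left_cancel h1

end Extend

/-! ### The ring `ℂ[z₁₁, z₁₂, z₂₁, z₂₂, N(Z)⁻¹]` -/

/-- `ℂ[z₁₁, z₁₂, z₂₁, z₂₂]`, the polynomial functions on `HC`. -/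
abbrev Poly : Type := MvPolynomial (Fin 2 × Fin 2) ℂ

/-- The generic element of `HC`, over the polynomial ring. -/
def polyZ : Matrix (Fin 2) (Fin 2) Poly := Matrix.of fun i j => MvPolynomial.X (i, j)

/-- The quaternionic norm `N(Z)`, which is `z₁₁ z₂₂ - z₁₂ z₂₁`. -/
def polyN : Poly := polyZ.det

/-- `ℂ[z₁₁, z₁₂, z₂₁, z₂₂, N(Z)⁻¹]`, the polynomial functions on the invertible elements
of `HC`. -/
abbrev Sh : Type := Localization.Away polyN

/-- The generic element `Z`, over `Sh`. -/
def Z : Matrix (Fin 2) (Fin 2) Sh := polyZ.map (algebraMap Poly Sh)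

/-- The element `N(Z)` of `Sh`. -/
def N : Sh := algebraMap Poly Sh polyN

/-- An element of `HC`, as a constant matrix over `Sh`. -/
def const (A : HC) : Matrix (Fin 2) (Fin 2) Sh := A.map (algebraMap ℂ Sh)

theorem isUnit_N : IsUnit N := IsLocalization.Away.algebraMap_isUnit polyN

/-- The partial derivative `∂_{ij} = ∂/∂z_{ij}` on `Sh`. -/
def partialD (i j : Fin 2) : Derivation ℂ Sh Sh :=
  extend polyN (MvPolynomial.mkDerivation ℂ (Pi.single (i, j) 1))

/-- The vector field `tr(W ∂) = ∑ W_{ij} ∂_{ij}`, where `∂` is the matrix with entry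
`∂_{ij}` in position `(j, i)`. -/
def trPartial (W : Matrix (Fin 2) (Fin 2) Sh) : Derivation ℂ Sh Sh :=
  ∑ i, ∑ j, W i j • partialD i j

/-! ### Differential operators -/

/-- The derivative `∂/∂z^k`, where `Z = ∑ z^k e_k`: the derivative in the direction `e_k`. -/
def quatD (k : Fin 4) : Derivation ℂ Sh Sh := trPartial (const (e k))

/-- `□ = ∑ (∂/∂z^k)²`. -/
def box : Sh →ₗ[ℂ] Sh := ∑ k, (quatD k : Sh →ₗ[ℂ] Sh) ∘ₗ (quatD k : Sh →ₗ[ℂ] Sh)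

/-- `Sh ⊗ 𝕊` (columns) or `Sh ⊗ 𝕊'` (rows): pairs of elements of `Sh`. Matrices act on columns
by `*ᵥ` and on rows by `ᵥ*`. -/
abbrev ShS : Type := Fin 2 → Sh

/-- A linear operator on `Sh`, acting on both components. -/
def compwise (T : Sh →ₗ[ℂ] Sh) : ShS →ₗ[ℂ] ShS where
  toFun f i := T (f i)
  map_add' f g := by ext i; simp
  map_smul' c f := by ext i; simp

/-- Left multiplication of columns by a matrix. -/
def mulLeft (M : Matrix (Fin 2) (Fin 2) Sh) : ShS →ₗ[ℂ] ShS where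
  toFun f := M.mulVec f
  map_add' f g := Matrix.mulVec_add M f g
  map_smul' c f := Matrix.mulVec_smul M c f

/-- Right multiplication of rows by a matrix. -/
def mulRight (M : Matrix (Fin 2) (Fin 2) Sh) : ShS →ₗ[ℂ] ShS where
  toFun g := Matrix.vecMul g M
  map_add' f g := Matrix.add_vecMul M f g
  map_smul' c f := Matrix.smul_vecMul c f M

/-- `∇ = e₀ ∂/∂z⁰ - e₁ ∂/∂z¹ - e₂ ∂/∂z² - e₃ ∂/∂z³` acting on columns from the left. -/
def nablaL : ShS →ₗ[ℂ] ShS :=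
  mulLeft (const (e 0)) ∘ₗ compwise (quatD 0) - mulLeft (const (e 1)) ∘ₗ compwise (quatD 1)
    - mulLeft (const (e 2)) ∘ₗ compwise (quatD 2) - mulLeft (const (e 3)) ∘ₗ compwise (quatD 3)

/-- The same operator `∇` acting on rows from the right. -/
def nablaR : ShS →ₗ[ℂ] ShS :=
  mulRight (const (e 0)) ∘ₗ compwise (quatD 0) - mulRight (const (e 1)) ∘ₗ compwise (quatD 1)
    - mulRight (const (e 2)) ∘ₗ compwise (quatD 2) - mulRight (const (e 3)) ∘ₗ compwise (quatD 3)

/-! ### The spaces of quasi anti regular functions -/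

/-- `𝒰`: the quasi left anti regular functions, `∇ □ f = 0`. -/
def U : Submodule ℂ ShS := LinearMap.ker (nablaL ∘ₗ compwise box)

/-- `𝒰'`: the quasi right anti regular functions, `(□ g) ∇ = 0`. -/
def U' : Submodule ℂ ShS := LinearMap.ker (nablaR ∘ₗ compwise box)

theorem isHomogeneous_polyN : polyN.IsHomogeneous 2 := by
  have h : ∀ i j k l : Fin 2,
      (MvPolynomial.X (i, j) * MvPolynomial.X (k, l) : Poly).IsHomogeneous 2 := fun i j k l =>
    (MvPolynomial.isHomogeneous_X ℂ (i, j)).mul (MvPolynomial.isHomogeneous_X ℂ (k, l))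
  simp only [polyN, Matrix.det_fin_two, polyZ, Matrix.of_apply]
  exact (h _ _ _ _).sub (h _ _ _ _)

/-- The elements of `Sh` that are homogeneous of degree `d`: the fractions `p / N(Z)^k` with `p`
a homogeneous polynomial of degree `d + 2 k`. -/
def shHomog (d : ℤ) : Submodule ℂ Sh where
  carrier := {f | ∃ (n k : ℕ) (p : Poly), p.IsHomogeneous n ∧ (n : ℤ) = d + 2 * k ∧
    f * N ^ k = algebraMap Poly Sh p}
  zero_mem' := ⟨(d + 2 * d.natAbs).toNat, d.natAbs, 0, MvPolynomial.isHomogeneous_zero _ _ _,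
    by omega, by simp⟩
  add_mem' := by
    rintro f g ⟨n, k, p, hp, hn, hf⟩ ⟨m, l, q, hq, hm, hg⟩
    refine ⟨n + 2 * l, k + l, p * polyN ^ l + q * polyN ^ k, ?_, by push_cast; omega, ?_⟩
    · have h1 := hp.mul (isHomogeneous_polyN.pow l)
      have h2 := hq.mul (isHomogeneous_polyN.pow k)
      have h3 : m + 2 * k = n + 2 * l := by omega
      rw [h3] at h2
      exact h1.add h2
    · simp only [map_add, map_mul, map_pow, ← hf, ← hg]
      change _ = f * N ^ k * N ^ l + g * N ^ l * N ^ k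
      ring
  smul_mem' := by
    rintro c f ⟨n, k, p, hp, hn, hf⟩
    refine ⟨n, k, c • p, ?_, hn, ?_⟩
    · rw [MvPolynomial.smul_eq_C_mul]
      exact hp.C_mul c
    · rw [smul_mul_assoc, hf, Algebra.smul_def, Algebra.smul_def, map_mul,
        ← IsScalarTower.algebraMap_apply]

/-- The pairs of elements of `Sh` homogeneous of degree `d`. -/
def homog (d : ℤ) : Submodule ℂ ShS := Submodule.pi Set.univ fun _ => shHomog d

/-- `𝒰(d)`. -/
def Udeg (d : ℤ) : Submodule ℂ ShS := U ⊓ homog d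

/-- `𝒰'(d)`. -/
def Udeg' (d : ℤ) : Submodule ℂ ShS := U' ⊓ homog d

/-- `𝒰⁺`, the sum of the `𝒰(d)` with `d ≥ 0`. -/
def Uplus : Submodule ℂ ShS := ⨆ (d : ℤ) (_ : 0 ≤ d), Udeg d

/-- `𝒰⁻`, the sum of the `𝒰(d)` with `d < 0`. -/
def Uminus : Submodule ℂ ShS := ⨆ (d : ℤ) (_ : d < 0), Udeg d

/-- `𝒰'⁺`, the sum of the `𝒰'(d)` with `d ≥ 0`. -/
def Uplus' : Submodule ℂ ShS := ⨆ (d : ℤ) (_ : 0 ≤ d), Udeg' d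

/-- `𝒰'⁻`, the sum of the `𝒰'(d)` with `d < 0`. -/
def Uminus' : Submodule ℂ ShS := ⨆ (d : ℤ) (_ : d < 0), Udeg' d

/-! ### The actions `π'_l` and `π'_r` of `gl(2, HC)` -/

/-- For `X = (A B; C D)`, the matrix `-AZ - B + ZCZ + ZD`, whose vector field `tr(W ∂)` is the
derivative part of the action of `X`. -/
def field (X : GLHC) : Matrix (Fin 2) (Fin 2) Sh :=
  -(const (X 0 0) * Z) - const (X 0 1) + Z * const (X 1 0) * Z + Z * const (X 1 1)

/-- For `X = (A B; C D)`, the multiplier `-tr(A) + A + tr(ZC) - ZC` of `π'_l(X)`. -/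
def multL (X : GLHC) : Matrix (Fin 2) (Fin 2) Sh :=
  -(const (X 0 0)).trace • 1 + const (X 0 0)
    + (Z * const (X 1 0)).trace • 1 - Z * const (X 1 0)

/-- For `X = (A B; C D)`, the multiplier `tr(CZ) - CZ + tr(D) - D` of `π'_r(X)`. -/
def multR (X : GLHC) : Matrix (Fin 2) (Fin 2) Sh :=
  (const (X 1 0) * Z).trace • 1 - const (X 1 0) * Z
    + (const (X 1 1)).trace • 1 - const (X 1 1)

/-- The operator `π'_l(X)`. -/
def opL (X : GLHC) : Module.End ℂ ShS :=
  compwise (trPartial (field X)) + mulLeft (multL X)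

/-- The operator `π'_r(X)`. -/
def opR (X : GLHC) : Module.End ℂ ShS :=
  compwise (trPartial (field X)) + mulRight (multR X)

theorem partialD_Z (i j k l : Fin 2) :
    partialD i j (Z k l) = if k = i ∧ l = j then 1 else 0 := by
  change extend polyN _ (algebraMap Poly Sh (MvPolynomial.X (k, l))) = _
  rw [extend_algebraMap, MvPolynomial.mkDerivation_X, Pi.single_apply]
  simp only [Prod.mk.injEq]

theorem trPartial_Z (W : Matrix (Fin 2) (Fin 2) Sh) (k l : Fin 2) :
    trPartial W (Z k l) = W k l := by
  simp only [trPartial, Fin.sum_univ_two, Derivation.add_apply, Derivation.smul_apply,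
    partialD_Z, smul_eq_mul]
  fin_cases k <;> fin_cases l <;> simp

theorem trPartial_const (W : Matrix (Fin 2) (Fin 2) Sh) (A : HC) (k l : Fin 2) :
    trPartial W (const A k l) = 0 := Derivation.map_algebraMap _ _

/-- Derivations of `Sh` are determined by their values on the coordinates. -/
theorem sh_derivation_ext {D E : Derivation ℂ Sh Sh} (h : ∀ k l, D (Z k l) = E (Z k l)) :
    D = E := by
  apply derivation_ext polyN
  have h2 : D.compAlgebraMap Poly = E.compAlgebraMap Poly := by
    apply MvPolynomial.derivation_ext
    rintro ⟨k, l⟩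
    exact h k l
  exact fun p => DFunLike.congr_fun h2 p

theorem const_add (A B : HC) : const (A + B) = const A + const B :=
  Matrix.map_add _ (map_add _) A B

theorem const_sub (A B : HC) : const (A - B) = const A - const B :=
  Matrix.map_sub _ (map_sub _) A B

theorem const_smul (c : ℂ) (A : HC) : const (c • A) = c • const A := by
  ext i j
  simp only [const, Matrix.map_apply, Matrix.smul_apply, smul_eq_mul, map_mul]
  rw [Algebra.smul_def]

theorem const_mul (A B : HC) : const (A * B) = const A * const B :=
  Matrix.map_mul

theorem map_mul_derivation (D : Derivation ℂ Sh Sh) (M L : Matrix (Fin 2) (Fin 2) Sh) :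
    (M * L).map D = M.map D * L + M * L.map D := by
  ext i j
  simp only [Matrix.map_apply, Matrix.mul_apply, Matrix.add_apply, Fin.sum_univ_two, map_add,
    Derivation.leibniz, smul_eq_mul]
  ring

theorem map_Z (W : Matrix (Fin 2) (Fin 2) Sh) : Z.map (trPartial W) = W := by
  ext i j
  exact trPartial_Z W i j

theorem map_const (W : Matrix (Fin 2) (Fin 2) Sh) (A : HC) :
    (const A).map (trPartial W) = 0 := by
  ext i j
  exact trPartial_const W A i j

theorem map_field (W : Matrix (Fin 2) (Fin 2) Sh) (Y : GLHC) :
    (field Y).map (trPartial W) = -(const (Y 0 0) * W) + W * const (Y 1 0) * Z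
      + Z * const (Y 1 0) * W + W * const (Y 1 1) := by
  have h : (field Y).map (trPartial W) =
      -(const (Y 0 0) * Z).map (trPartial W) - (const (Y 0 1)).map (trPartial W)
        + (Z * const (Y 1 0) * Z).map (trPartial W) + (Z * const (Y 1 1)).map (trPartial W) := by
    ext i j
    simp only [field, Matrix.map_apply, Matrix.add_apply, Matrix.sub_apply, Matrix.neg_apply,
      map_add, map_sub, map_neg]
  rw [h]
  simp only [map_mul_derivation, map_Z, map_const]
  noncomm_ring

theorem bracket_apply (X Y : GLHC) (i j : Fin 2) :
    ⁅X, Y⁆ i j = X i 0 * Y 0 j + X i 1 * Y 1 j - (Y i 0 * X 0 j + Y i 1 * X 1 j) := by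
  simp only [Ring.lie_def, Matrix.sub_apply, Matrix.mul_apply, Fin.sum_univ_two]

theorem field_lie (X Y : GLHC) :
    (field Y).map (trPartial (field X)) - (field X).map (trPartial (field Y))
      = field ⁅X, Y⁆ := by
  rw [map_field, map_field]
  simp only [field, bracket_apply, const_add, const_sub, const_mul]
  noncomm_ring

theorem trPartial_lie (X Y : GLHC) :
    ⁅trPartial (field X), trPartial (field Y)⁆ = trPartial (field ⁅X, Y⁆) := by
  apply sh_derivation_ext
  intro k l
  rw [Derivation.commutator_apply, trPartial_Z, trPartial_Z, trPartial_Z, ← field_lie]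
  rfl

theorem trPartial_add (V W : Matrix (Fin 2) (Fin 2) Sh) :
    trPartial (V + W) = trPartial V + trPartial W := by
  simp only [trPartial, Matrix.add_apply, add_smul, Finset.sum_add_distrib]

theorem trPartial_smul (c : ℂ) (W : Matrix (Fin 2) (Fin 2) Sh) :
    trPartial (c • W) = c • trPartial W := by
  simp only [trPartial, Matrix.smul_apply, smul_assoc, Finset.smul_sum]

theorem field_add (X Y : GLHC) : field (X + Y) = field X + field Y := by
  simp only [field, Matrix.add_apply, const_add]
  noncomm_ring

theorem field_smul (c : ℂ) (X : GLHC) : field (c • X) = c • field X := by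
  simp only [field, Matrix.smul_apply, const_smul, smul_add, smul_sub, smul_neg, smul_mul_assoc,
    mul_smul_comm]

/-- `A - ZC`. -/
def quotL (X : GLHC) : Matrix (Fin 2) (Fin 2) Sh := const (X 0 0) - Z * const (X 1 0)

/-- `CZ + D`. -/
def quotR (X : GLHC) : Matrix (Fin 2) (Fin 2) Sh := const (X 1 0) * Z + const (X 1 1)

theorem multL_eq (X : GLHC) :
    multL X = quotL X - (quotL X).trace • (1 : Matrix (Fin 2) (Fin 2) Sh) := by
  simp only [multL, quotL, Matrix.trace_sub, sub_smul, neg_smul]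
  abel

theorem multR_eq (X : GLHC) :
    multR X = (quotR X).trace • (1 : Matrix (Fin 2) (Fin 2) Sh) - quotR X := by
  simp only [multR, quotR, Matrix.trace_add, add_smul]
  abel

theorem quotL_lie (X Y : GLHC) :
    (quotL Y).map (trPartial (field X)) - (quotL X).map (trPartial (field Y))
      + (quotL X * quotL Y - quotL Y * quotL X) = quotL ⁅X, Y⁆ := by
  have h : ∀ (W : Matrix (Fin 2) (Fin 2) Sh) (X : GLHC),
      (quotL X).map (trPartial W) = -(W * const (X 1 0)) := by
    intro W X
    have h1 : (quotL X).map (trPartial W) =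
        (const (X 0 0)).map (trPartial W) - (Z * const (X 1 0)).map (trPartial W) := by
      ext i j
      simp only [quotL, Matrix.map_apply, Matrix.sub_apply, map_sub]
    rw [h1, map_mul_derivation, map_Z, map_const, map_const]
    noncomm_ring
  rw [h, h]
  simp only [quotL, field, bracket_apply, const_add, const_sub, const_mul]
  noncomm_ring

theorem quotR_lie (X Y : GLHC) :
    (quotR Y).map (trPartial (field X)) - (quotR X).map (trPartial (field Y))
      + (quotR X * quotR Y - quotR Y * quotR X) = quotR ⁅X, Y⁆ := by
  have h : ∀ (W : Matrix (Fin 2) (Fin 2) Sh) (X : GLHC),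
      (quotR X).map (trPartial W) = const (X 1 0) * W := by
    intro W X
    have h1 : (quotR X).map (trPartial W) =
        (const (X 1 0) * Z).map (trPartial W) + (const (X 1 1)).map (trPartial W) := by
      ext i j
      simp only [quotR, Matrix.map_apply, Matrix.add_apply, map_add]
    rw [h1, map_mul_derivation, map_Z, map_const, map_const]
    noncomm_ring
  rw [h, h]
  simp only [quotR, field, bracket_apply, const_add, const_sub, const_mul]
  noncomm_ring

theorem opL_apply (X : GLHC) (f : ShS) (i : Fin 2) :
    opL X f i = trPartial (field X) (f i)
      + (quotL X i 0 * f 0 + quotL X i 1 * f 1 - (quotL X 0 0 + quotL X 1 1) * f i) := by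
  have h : opL X f i = trPartial (field X) (f i) + ((multL X).mulVec f) i := rfl
  rw [h, multL_eq, Matrix.sub_mulVec, Matrix.smul_mulVec, Matrix.one_mulVec]
  simp only [Pi.sub_apply, Pi.smul_apply, smul_eq_mul, Matrix.mulVec, dotProduct,
    Fin.sum_univ_two, Matrix.trace_fin_two]

theorem opR_apply (X : GLHC) (g : ShS) (i : Fin 2) :
    opR X g i = trPartial (field X) (g i)
      + ((quotR X 0 0 + quotR X 1 1) * g i - (g 0 * quotR X 0 i + g 1 * quotR X 1 i)) := by
  have h : opR X g i = trPartial (field X) (g i) + (Matrix.vecMul g (multR X)) i := rfl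
  rw [h, multR_eq, Matrix.vecMul_sub, Matrix.vecMul_smul, Matrix.vecMul_one]
  simp only [Pi.sub_apply, Pi.smul_apply, smul_eq_mul, Matrix.vecMul, dotProduct,
    Fin.sum_univ_two, Matrix.trace_fin_two]

theorem opL_lie (X Y : GLHC) : opL ⁅X, Y⁆ = ⁅opL X, opL Y⁆ := by
  refine LinearMap.ext fun f => funext fun i => ?_
  have hq : ∀ k l, quotL ⁅X, Y⁆ k l = trPartial (field X) (quotL Y k l)
      - trPartial (field Y) (quotL X k l)
      + ((quotL X k 0 * quotL Y 0 l + quotL X k 1 * quotL Y 1 l)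
        - (quotL Y k 0 * quotL X 0 l + quotL Y k 1 * quotL X 1 l)) := by
    intro k l
    rw [← quotL_lie]
    simp only [Matrix.add_apply, Matrix.sub_apply, Matrix.map_apply, Matrix.mul_apply,
      Fin.sum_univ_two]
  have hb : ⁅opL X, opL Y⁆ f i = opL X (opL Y f) i - opL Y (opL X f) i := rfl
  rw [hb]
  simp only [opL_apply, hq, ← trPartial_lie, Derivation.commutator_apply, map_add, map_sub,
    Derivation.leibniz, smul_eq_mul]
  generalize trPartial (field X) = D
  generalize trPartial (field Y) = E
  generalize quotL X = M
  generalize quotL Y = L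
  fin_cases i <;> simp only [Fin.zero_eta, Fin.mk_one] <;> ring

theorem opR_lie (X Y : GLHC) : opR ⁅X, Y⁆ = ⁅opR X, opR Y⁆ := by
  refine LinearMap.ext fun f => funext fun i => ?_
  have hq : ∀ k l, quotR ⁅X, Y⁆ k l = trPartial (field X) (quotR Y k l)
      - trPartial (field Y) (quotR X k l)
      + ((quotR X k 0 * quotR Y 0 l + quotR X k 1 * quotR Y 1 l)
        - (quotR Y k 0 * quotR X 0 l + quotR Y k 1 * quotR X 1 l)) := by
    intro k l
    rw [← quotR_lie]
    simp only [Matrix.add_apply, Matrix.sub_apply, Matrix.map_apply, Matrix.mul_apply,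
      Fin.sum_univ_two]
  have hb : ⁅opR X, opR Y⁆ f i = opR X (opR Y f) i - opR Y (opR X f) i := rfl
  rw [hb]
  simp only [opR_apply, hq, ← trPartial_lie, Derivation.commutator_apply, map_add, map_sub,
    Derivation.leibniz, smul_eq_mul]
  generalize trPartial (field X) = D
  generalize trPartial (field Y) = E
  generalize quotR X = M
  generalize quotR Y = L
  fin_cases i <;> simp only [Fin.zero_eta, Fin.mk_one] <;> ring

theorem quotL_add (X Y : GLHC) : quotL (X + Y) = quotL X + quotL Y := by
  simp only [quotL, Matrix.add_apply, const_add]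
  noncomm_ring

theorem quotL_smul (c : ℂ) (X : GLHC) : quotL (c • X) = c • quotL X := by
  simp only [quotL, Matrix.smul_apply, const_smul, smul_sub, mul_smul_comm]

theorem quotR_add (X Y : GLHC) : quotR (X + Y) = quotR X + quotR Y := by
  simp only [quotR, Matrix.add_apply, const_add]
  noncomm_ring

theorem quotR_smul (c : ℂ) (X : GLHC) : quotR (c • X) = c • quotR X := by
  simp only [quotR, Matrix.smul_apply, const_smul, smul_add, smul_mul_assoc]

/-- The representation `π'_l` of `gl(2, HC)` on `Sh ⊗ 𝕊`. -/
def piL : GLHC →ₗ⁅ℂ⁆ Module.End ℂ ShS where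
  toFun := opL
  map_add' X Y := by
    refine LinearMap.ext fun f => funext fun i => ?_
    rw [LinearMap.add_apply, Pi.add_apply]
    simp only [opL_apply, field_add, trPartial_add, quotL_add, Matrix.add_apply,
      Derivation.add_apply]
    ring
  map_smul' c X := by
    refine LinearMap.ext fun f => funext fun i => ?_
    rw [RingHom.id_apply, LinearMap.smul_apply, Pi.smul_apply]
    simp only [opL_apply, field_smul, trPartial_smul, quotL_smul, Matrix.smul_apply,
      Derivation.smul_apply, smul_add, smul_sub, smul_mul_assoc, add_mul]
  map_lie' {X Y} := opL_lie X Y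

/-- The representation `π'_r` of `gl(2, HC)` on `Sh ⊗ 𝕊'`. -/
def piR : GLHC →ₗ⁅ℂ⁆ Module.End ℂ ShS where
  toFun := opR
  map_add' X Y := by
    refine LinearMap.ext fun f => funext fun i => ?_
    rw [LinearMap.add_apply, Pi.add_apply]
    simp only [opR_apply, field_add, trPartial_add, quotR_add, Matrix.add_apply,
      Derivation.add_apply]
    ring
  map_smul' c X := by
    refine LinearMap.ext fun f => funext fun i => ?_
    rw [RingHom.id_apply, LinearMap.smul_apply, Pi.smul_apply]
    simp only [opR_apply, field_smul, trPartial_smul, quotR_smul, Matrix.smul_apply,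
      Derivation.smul_apply, smul_add, smul_sub, smul_mul_assoc, mul_smul_comm, add_mul]
  map_lie' {X Y} := opR_lie X Y

/-! ### The group actions, and `π'_l`, `π'_r` as their derivatives -/

/-- The value at `V` of an element of `Sh`, regarded as a function on the invertible elements
of `HC` (extended by `0` to the non-invertible ones). -/
def evalSh (V : HC) (f : Sh) : ℂ :=
  if h : V.det ≠ 0 then
    IsLocalization.Away.lift (S := Sh) (g := MvPolynomial.eval fun p => V p.1 p.2) polyN
      (by
        have h2 : (MvPolynomial.eval fun p => V p.1 p.2) polyN = V.det := by
          simp [polyN, polyZ, Matrix.det_fin_two]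
        rw [h2]
        exact isUnit_iff_ne_zero.mpr h) f
  else 0

/-- The action of `h = (a' b'; c' d') ∈ GL(2, HC)` on `𝕊`-valued functions:
`F(V) ↦ (a' - V c') / N(a' - V c') · F((a' - V c')⁻¹ (-b' + V d'))`. -/
def groupL (h : GLHC) (F : HC → Fin 2 → ℂ) (V : HC) : Fin 2 → ℂ :=
  Matrix.mulVec (((h 0 0 - V * h 1 0).det)⁻¹ • (h 0 0 - V * h 1 0))
    (F ((h 0 0 - V * h 1 0)⁻¹ * (-(h 0 1) + V * h 1 1)))

/-- The action on `𝕊'`-valued functions of the element of `GL(2, HC)` whose inverse is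
`k = (a b; c d)`: `G(V) ↦ G((a V + b) (c V + d)⁻¹) · (c V + d) / N(c V + d)`. -/
def groupR (k : GLHC) (G : HC → Fin 2 → ℂ) (V : HC) : Fin 2 → ℂ :=
  Matrix.vecMul (G ((k 0 0 * V + k 0 1) * (k 1 0 * V + k 1 1)⁻¹))
    (((k 1 0 * V + k 1 1).det)⁻¹ • (k 1 0 * V + k 1 1))

theorem evalSh_eq {V : HC} (h : V.det ≠ 0) :
    ∃ φ : Sh →+* ℂ, (∀ f, evalSh V f = φ f) ∧
      ∀ p, φ (algebraMap Poly Sh p) = MvPolynomial.eval (fun p => V p.1 p.2) p := by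
  have h2 : IsUnit ((MvPolynomial.eval fun p : Fin 2 × Fin 2 => V p.1 p.2) polyN) := by
    have h3 : (MvPolynomial.eval fun p => V p.1 p.2) polyN = V.det := by
      simp [polyN, polyZ, Matrix.det_fin_two]
    rw [h3]
    exact isUnit_iff_ne_zero.mpr h
  refine ⟨IsLocalization.Away.lift (S := Sh) polyN h2, fun f => ?_, fun p => ?_⟩
  · rw [evalSh, dif_pos h]
  · exact IsLocalization.Away.lift_eq polyN h2 p

theorem evalSh_const {V : HC} (h : V.det ≠ 0) (A : HC) (i j : Fin 2) :
    evalSh V (const A i j) = A i j := by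
  obtain ⟨φ, h1, h2⟩ := evalSh_eq h
  have h3 : const A i j = algebraMap Poly Sh (MvPolynomial.C (A i j)) := by
    simp only [const, Matrix.map_apply, IsScalarTower.algebraMap_apply ℂ Poly Sh,
      MvPolynomial.algebraMap_eq]
  rw [h1, h3, h2, MvPolynomial.eval_C]

theorem evalSh_Z {V : HC} (h : V.det ≠ 0) (i j : Fin 2) : evalSh V (Z i j) = V i j := by
  obtain ⟨φ, h1, h2⟩ := evalSh_eq h
  have h3 : Z i j = algebraMap Poly Sh (MvPolynomial.X (i, j)) := rfl
  rw [h1, h3, h2, MvPolynomial.eval_X]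

theorem hasDerivAt_evalSh {γ : ℂ → HC} {V : HC} {W : Matrix (Fin 2) (Fin 2) Sh}
    (h0 : γ 0 = V) (hV : V.det ≠ 0)
    (hγ : ∀ i j, HasDerivAt (fun t => γ t i j) (evalSh V (W i j)) 0) (f : Sh) :
    HasDerivAt (fun t => evalSh (γ t) f) (evalSh V (trPartial W f)) 0 := by
  subst h0
  obtain ⟨φ, h1, h2⟩ := evalSh_eq hV
  have hdet : ContinuousAt (fun t => (γ t).det) 0 := by
    simp only [Matrix.det_fin_two]
    exact (((hγ 0 0).continuousAt.mul (hγ 1 1).continuousAt).sub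
      ((hγ 0 1).continuousAt.mul (hγ 1 0).continuousAt))
  have hev : ∀ᶠ t in nhds (0 : ℂ), (γ t).det ≠ 0 := hdet.eventually_ne hV
  have hp : ∀ p : Poly, HasDerivAt (fun t => MvPolynomial.eval (fun q => γ t q.1 q.2) p)
      (evalSh (γ 0) (trPartial W (algebraMap Poly Sh p))) 0 := by
    intro p
    rw [h1]
    induction p using MvPolynomial.induction_on with
    | C a =>
      have h3 : trPartial W (algebraMap Poly Sh (MvPolynomial.C a)) = 0 := by
        rw [← MvPolynomial.algebraMap_eq, ← IsScalarTower.algebraMap_apply]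
        exact Derivation.map_algebraMap _ _
      simp only [h3, map_zero, MvPolynomial.eval_C]
      exact hasDerivAt_const _ _
    | add p q hp hq =>
      simp only [map_add]
      exact hp.add hq
    | mul_X p i hp =>
      obtain ⟨k, l⟩ := i
      have h3 : trPartial W (algebraMap Poly Sh (MvPolynomial.X (k, l))) = W k l :=
        trPartial_Z W k l
      have h4 := hp.mul (hγ k l)
      rw [h1] at h4
      simp only [map_mul, Derivation.leibniz, h3, smul_eq_mul, map_add, MvPolynomial.eval_X]
      refine h4.congr_deriv ?_
      simp only [h2, MvPolynomial.eval_X]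
      ring
  obtain ⟨n, p, hn⟩ := IsLocalization.Away.surj polyN f
  have hN : ∀ V : HC, (MvPolynomial.eval fun p => V p.1 p.2) polyN = V.det := by
    intro V
    simp [polyN, polyZ, Matrix.det_fin_two]
  have key : ∀ t, (γ t).det ≠ 0 → evalSh (γ t) f =
      MvPolynomial.eval (fun q => γ t q.1 q.2) p
        / MvPolynomial.eval (fun q => γ t q.1 q.2) (polyN ^ n) := by
    intro t ht
    obtain ⟨ψ, h3, h4⟩ := evalSh_eq ht
    have hz : MvPolynomial.eval (fun q => γ t q.1 q.2) (polyN ^ n) ≠ 0 := by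
      rw [map_pow, hN]
      exact pow_ne_zero _ ht
    rw [eq_div_iff hz, h3, ← h4, ← h4, ← hn, map_mul, map_pow (algebraMap Poly Sh)]
  have hne : MvPolynomial.eval (fun q => γ 0 q.1 q.2) (polyN ^ n) ≠ 0 := by
    rw [map_pow, hN]
    exact pow_ne_zero _ hV
  have hd := ((hp p).div (hp (polyN ^ n)) hne).congr_of_eventuallyEq
    (hev.mono fun t ht => key t ht)
  refine hd.congr_deriv ?_
  rw [div_eq_iff (pow_ne_zero 2 hne), h1, h1, h1, ← h2, ← h2, ← hn, map_pow]
  simp only [Derivation.leibniz (trPartial W) f, smul_eq_mul, map_add, map_mul]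
  ring

theorem hasDerivAt_det_inv {M : ℂ → HC} {M' : HC} (h0 : M 0 = 1)
    (h : ∀ i j, HasDerivAt (fun t => M t i j) (M' i j) 0) :
    HasDerivAt (fun t => ((M t).det)⁻¹) (-(M' 0 0 + M' 1 1)) 0 := by
  have hd : HasDerivAt (fun t => (M t).det) (M' 0 0 + M' 1 1) 0 := by
    simp only [Matrix.det_fin_two]
    refine (((h 0 0).mul (h 1 1)).sub ((h 0 1).mul (h 1 0))).congr_deriv ?_
    simp [h0]
  have hd0 : (M 0).det ≠ 0 := by simp [h0]
  refine (hd.inv hd0).congr_deriv ?_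
  simp [h0]

theorem hasDerivAt_inv {M : ℂ → HC} {M' : HC} (h0 : M 0 = 1)
    (h : ∀ i j, HasDerivAt (fun t => M t i j) (M' i j) 0) (i j : Fin 2) :
    HasDerivAt (fun t => (M t)⁻¹ i j) (-(M' i j)) 0 := by
  have hi := hasDerivAt_det_inv h0 h
  simp only [Matrix.inv_def, Ring.inverse_eq_inv', Matrix.smul_apply, smul_eq_mul,
    Matrix.adjugate_fin_two]
  fin_cases i <;> fin_cases j <;> simp only [Fin.zero_eta, Fin.mk_one, Matrix.of_apply,
    Matrix.cons_val', Matrix.cons_val_zero, Matrix.cons_val_one, Matrix.cons_val_fin_one]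
  · refine (hi.mul (h 1 1)).congr_deriv ?_
    simp [h0]
  · refine (hi.mul (h 0 1).neg).congr_deriv ?_
    simp [h0]
  · refine (hi.mul (h 1 0).neg).congr_deriv ?_
    simp [h0]
  · refine (hi.mul (h 0 0)).congr_deriv ?_
    simp [h0]

theorem hasDerivAt_matMul {M L : ℂ → HC} {M' L' : HC}
    (hM : ∀ i j, HasDerivAt (fun t => M t i j) (M' i j) 0)
    (hL : ∀ i j, HasDerivAt (fun t => L t i j) (L' i j) 0) (i j : Fin 2) :
    HasDerivAt (fun t => (M t * L t) i j) ((M' * L 0 + M 0 * L') i j) 0 := by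
  simp only [Matrix.mul_apply, Matrix.add_apply, Fin.sum_univ_two]
  refine (((hM i 0).mul (hL 0 j)).add ((hM i 1).mul (hL 1 j))).congr_deriv ?_
  ring

theorem hasDerivAt_const_mul (V : HC) {M : ℂ → HC} {M' : HC}
    (hM : ∀ i j, HasDerivAt (fun t => M t i j) (M' i j) 0) (i j : Fin 2) :
    HasDerivAt (fun t => (V * M t) i j) ((V * M') i j) 0 := by
  simp only [Matrix.mul_apply, Fin.sum_univ_two]
  exact ((hM 0 j).const_mul _).add ((hM 1 j).const_mul _)

theorem hasDerivAt_mul_const (V : HC) {M : ℂ → HC} {M' : HC}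
    (hM : ∀ i j, HasDerivAt (fun t => M t i j) (M' i j) 0) (i j : Fin 2) :
    HasDerivAt (fun t => (M t * V) i j) ((M' * V) i j) 0 := by
  simp only [Matrix.mul_apply, Fin.sum_univ_two]
  exact ((hM i 0).mul_const _).add ((hM i 1).mul_const _)

/-- `π'_l(X)` is the derivative at `t = 0` of `π'_l(h(t))`, for every curve `h` with `h(0) = 1`
and `h'(0) = X`, such as `h(t) = exp(t X)`. -/
theorem hasDerivAt_groupL (X : GLHC) (h : ℂ → GLHC) (h0 : h 0 = 1)
    (h' : ∀ i j k l, HasDerivAt (fun t => h t i j k l) (X i j k l) 0)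
    (f : ShS) (V : HC) (hV : V.det ≠ 0) (i : Fin 2) :
    HasDerivAt (fun t => groupL (h t) (fun V j => evalSh V (f j)) V i)
      (evalSh V (piL X f i)) 0 := by
  have hM : ∀ k l, HasDerivAt (fun t => (h t 0 0 - V * h t 1 0) k l)
      ((X 0 0 - V * X 1 0) k l) 0 := fun k l =>
    (h' 0 0 k l).sub (hasDerivAt_const_mul V (h' 1 0) k l)
  have hL : ∀ k l, HasDerivAt (fun t => (-(h t 0 1) + V * h t 1 1) k l)
      ((-(X 0 1) + V * X 1 1) k l) 0 := fun k l =>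
    (h' 0 1 k l).neg.add (hasDerivAt_const_mul V (h' 1 1) k l)
  have hM0 : h 0 0 0 - V * h 0 1 0 = 1 := by simp [h0]
  have hL0 : -(h 0 0 1) + V * h 0 1 1 = V := by simp [h0]
  have hI := hasDerivAt_inv (M := fun t => h t 0 0 - V * h t 1 0) hM0 hM
  have hG := hasDerivAt_matMul (M := fun t => (h t 0 0 - V * h t 1 0)⁻¹)
    (L := fun t => -(h t 0 1) + V * h t 1 1) (M' := -(X 0 0 - V * X 1 0)) hI hL
  have hD := hasDerivAt_det_inv (M := fun t => h t 0 0 - V * h t 1 0) hM0 hM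
  obtain ⟨φ, h1, -⟩ := evalSh_eq hV
  have hZ : ∀ k l, φ (Z k l) = V k l := fun k l => by rw [← h1, evalSh_Z hV]
  have hc : ∀ A k l, φ (const A k l) = A k l := fun A k l => by rw [← h1, evalSh_const hV]
  have hF := hasDerivAt_evalSh (V := V) (W := field X)
    (γ := fun t => (h t 0 0 - V * h t 1 0)⁻¹ * (-(h t 0 1) + V * h t 1 1))
    (by simp [hM0, hL0]) hV (fun k l => by
      refine (hG k l).congr_deriv ?_
      simp only [hM0, hL0, inv_one, h1, field, Matrix.add_apply, Matrix.sub_apply,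
        Matrix.neg_apply, Matrix.mul_apply, Fin.sum_univ_two, map_add, map_sub, map_neg, map_mul,
        hZ, hc, Matrix.one_apply]
      fin_cases k <;> fin_cases l <;> simp <;> ring)
  have e0 := (hD.mul (hM i 0)).mul (hF (f 0))
  have e1 := (hD.mul (hM i 1)).mul (hF (f 1))
  refine ((e0.add e1).congr_of_eventuallyEq (Filter.Eventually.of_forall fun t => ?_)).congr_deriv ?_
  · simp only [groupL, Matrix.mulVec, dotProduct, Fin.sum_univ_two, Matrix.smul_apply,
      smul_eq_mul, Pi.add_apply, Pi.mul_apply]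
  have hop : piL X f i = opL X f i := rfl
  rw [hop, opL_apply]
  simp only [Pi.mul_apply, hM0, hL0]
  simp only [h1, quotL, Matrix.sub_apply, Matrix.mul_apply, Fin.sum_univ_two, map_add,
    map_sub, map_mul, hZ, hc, inv_one, Matrix.one_mul, Matrix.det_one]
  obtain rfl | rfl : i = 0 ∨ i = 1 := by omega
  · simp
    ring
  · simp
    ring

/-- `π'_r(X)` is the derivative at `t = 0` of `π'_r(h(t))`, for every curve `h` with `h(0) = 1`
and `h'(0) = X`; here `k(t)` is the inverse of `h(t)`, so that `k'(0) = -X`. -/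
theorem hasDerivAt_groupR (X : GLHC) (k : ℂ → GLHC) (k0 : k 0 = 1)
    (k' : ∀ i j p q, HasDerivAt (fun t => k t i j p q) (-(X i j p q)) 0)
    (g : ShS) (V : HC) (hV : V.det ≠ 0) (i : Fin 2) :
    HasDerivAt (fun t => groupR (k t) (fun V j => evalSh V (g j)) V i)
      (evalSh V (piR X g i)) 0 := by
  have hM : ∀ p q, HasDerivAt (fun t => (k t 1 0 * V + k t 1 1) p q)
      ((-(X 1 0) * V + -(X 1 1)) p q) 0 := fun p q =>
    (hasDerivAt_mul_const V (M' := -(X 1 0)) (k' 1 0) p q).add (k' 1 1 p q)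
  have hL : ∀ p q, HasDerivAt (fun t => (k t 0 0 * V + k t 0 1) p q)
      ((-(X 0 0) * V + -(X 0 1)) p q) 0 := fun p q =>
    (hasDerivAt_mul_const V (M' := -(X 0 0)) (k' 0 0) p q).add (k' 0 1 p q)
  have hM0 : k 0 1 0 * V + k 0 1 1 = 1 := by simp [k0]
  have hL0 : k 0 0 0 * V + k 0 0 1 = V := by simp [k0]
  have hI := hasDerivAt_inv (M := fun t => k t 1 0 * V + k t 1 1) hM0 hM
  have hG := hasDerivAt_matMul (M := fun t => k t 0 0 * V + k t 0 1)
    (L := fun t => (k t 1 0 * V + k t 1 1)⁻¹) (L' := -(-(X 1 0) * V + -(X 1 1))) hL hI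
  have hD := hasDerivAt_det_inv (M := fun t => k t 1 0 * V + k t 1 1) hM0 hM
  obtain ⟨φ, h1, -⟩ := evalSh_eq hV
  have hZ : ∀ k l, φ (Z k l) = V k l := fun k l => by rw [← h1, evalSh_Z hV]
  have hc : ∀ A k l, φ (const A k l) = A k l := fun A k l => by rw [← h1, evalSh_const hV]
  have hF := hasDerivAt_evalSh (V := V) (W := field X)
    (γ := fun t => (k t 0 0 * V + k t 0 1) * (k t 1 0 * V + k t 1 1)⁻¹)
    (by simp [hM0, hL0]) hV (fun p q => by
      refine (hG p q).congr_deriv ?_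
      simp only [hM0, hL0, inv_one, h1, field, Matrix.add_apply, Matrix.sub_apply,
        Matrix.neg_apply, Matrix.mul_apply, Fin.sum_univ_two, map_add, map_sub, map_neg, map_mul,
        hZ, hc, Matrix.one_apply]
      fin_cases p <;> fin_cases q <;> simp <;> ring)
  have e0 := (hF (g 0)).mul (hD.mul (hM 0 i))
  have e1 := (hF (g 1)).mul (hD.mul (hM 1 i))
  refine ((e0.add e1).congr_of_eventuallyEq (Filter.Eventually.of_forall fun t => ?_)).congr_deriv ?_
  · simp only [groupR, Matrix.vecMul, dotProduct, Fin.sum_univ_two, Matrix.smul_apply,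
      smul_eq_mul, Pi.add_apply, Pi.mul_apply]
  have hop : piR X g i = opR X g i := rfl
  rw [hop, opR_apply]
  simp only [Pi.mul_apply, hM0, hL0]
  simp only [h1, quotR, Matrix.add_apply, Matrix.mul_apply, Fin.sum_univ_two, map_add,
    map_sub, map_mul, hZ, hc, inv_one, Matrix.mul_one, Matrix.det_one, Matrix.neg_apply]
  obtain rfl | rfl : i = 0 ∨ i = 1 := by omega
  · simp
    ring
  · simp
    ring

/-! ### Irreducible representations -/

/-- `W` is a nonzero subspace of `V` that is invariant under the representation `ρ` of `L`, and
the representation of `L` on `W` is irreducible: its only invariant subspaces are `0` and `W`. -/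
def IsIrreducibleOn {L V : Type} [LieRing L] [LieAlgebra ℂ L] [AddCommGroup V] [Module ℂ V]
    (ρ : L →ₗ⁅ℂ⁆ Module.End ℂ V) (W : Submodule ℂ V) : Prop :=
  (∀ X : L, ∀ w ∈ W, ρ X w ∈ W) ∧ W ≠ ⊥ ∧
    ∀ W' : Submodule ℂ V, W' ≤ W → (∀ X : L, ∀ w ∈ W', ρ X w ∈ W') → W' = ⊥ ∨ W' = W

end

end QuasiRegular

namespace QuasiRegular

noncomputable section

/-! ### Coordinate form of the differential operators -/

/-! In matrix coordinates `□` is `4 * lap` and `∇` is twice `diracL` (columns) or `diracR` (rows),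
so `𝒰` is the kernel of `diracL ∘ lap2`. The action splits into four blocks: translations (`B`) are
constant-coefficient derivatives and lower the degree by one, special conformal transformations
(`C`) raise it by one, and the diagonal blocks preserve it. Each block carries `∇□` into expressions
linear in `∇□f`, hence preserves `𝒰`. The two halves separate because `𝒰(0)` consists of constants,
killed by translations (`mem_Udeg_zero`), and `𝒰(-1)` consists of the columns `N⁻¹ Z c`, killed by
the special transformations (`mem_Udeg_neg_one`, `special_invS`).

For irreducibility, the element `diag(-1, 1)` of `sl(2, HC)` acts on degree `d` by `2d + 1`, so
invariant subspaces are graded. The sum of products raising × lowering is half of a Casimir operator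
and acts on `𝒰(d)` as `d² - 2 N lap - Z diracL`. For `d ≠ 0, -1` the component `𝒰(d)` is a sum of
joint eigenspaces (`Udeg_decomposition`), on which this operator has the values `d²`, `d² - d - 1`,
`d² - 2d - 1`. None of them vanishes for `d ≥ 1`, so `𝒰(d)` is regained from `𝒰(d - 1)`. Conversely,
by Euler's identity some partial derivative of a nonzero element of positive degree is nonzero. Thus
a nonzero invariant subspace of `𝒰⁺` descends to `𝒰(0) ≅ ℂ²`, contains all of it since `E₁₂` and
`E₂₁` act irreducibly there, and climbs back through every degree.

For `𝒰⁻` the roles of raising and lowering are exchanged: lowering × raising has the values `d² + 4d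
+ 2`, `d² + 3d + 1`, `(d + 1)²`, all nonzero for `d ≤ -2`, and the extremal component is `𝒰(-1)`.
The statements for rows follow from those for columns by the substitution `Z ↦ Zᵀ` (`opR_tr2`). -/

theorem const_apply (A : HC) (i j : Fin 2) : const A i j = algebraMap ℂ Sh (A i j) := rfl

theorem partialD_comm (i j k l : Fin 2) (f : Sh) :
    partialD i j (partialD k l f) = partialD k l (partialD i j f) := by
  have h : ⁅partialD i j, partialD k l⁆ = 0 := by
    apply sh_derivation_ext
    intro p q
    rw [Derivation.commutator_apply, partialD_Z, partialD_Z]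
    split_ifs <;> simp
  have h2 := DFunLike.congr_fun h f
  rw [Derivation.commutator_apply, Derivation.zero_apply, sub_eq_zero] at h2
  exact h2

theorem partialD_algebraMap (i j : Fin 2) (c : ℂ) : partialD i j (algebraMap ℂ Sh c) = 0 :=
  Derivation.map_algebraMap _ _

theorem partialD_algebraMap_poly (i j : Fin 2) (p : Poly) :
    partialD i j (algebraMap Poly Sh p) = algebraMap Poly Sh (MvPolynomial.pderiv (i, j) p) := by
  induction p using MvPolynomial.induction_on with
  | C a =>
    rw [← MvPolynomial.algebraMap_eq, ← IsScalarTower.algebraMap_apply, partialD_algebraMap,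
      MvPolynomial.algebraMap_eq, MvPolynomial.pderiv_C, map_zero]
  | add p q hp hq => simp only [map_add, hp, hq]
  | mul_X p k hp =>
    obtain ⟨k, l⟩ := k
    have h : algebraMap Poly Sh (MvPolynomial.X (k, l)) = Z k l := rfl
    have h2 : algebraMap Poly Sh (MvPolynomial.pderiv (i, j) (MvPolynomial.X (k, l)))
        = partialD i j (Z k l) := by
      rw [partialD_Z, MvPolynomial.pderiv_X, Pi.single_apply]
      simp only [Prod.mk.injEq]
      split_ifs <;> simp
    simp only [map_mul, Derivation.leibniz, hp, smul_eq_mul, map_add, h, h2]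

theorem N_eq : N = Z 0 0 * Z 1 1 - Z 0 1 * Z 1 0 := by
  simp only [N, polyN, Matrix.det_fin_two, map_sub, map_mul]
  rfl

/-- The operator `∂₁₁ ∂₂₂ - ∂₁₂ ∂₂₁`, a quarter of `□`. -/
def lap : Sh →ₗ[ℂ] Sh :=
  (partialD 0 0 : Sh →ₗ[ℂ] Sh) ∘ₗ (partialD 1 1 : Sh →ₗ[ℂ] Sh)
    - (partialD 0 1 : Sh →ₗ[ℂ] Sh) ∘ₗ (partialD 1 0 : Sh →ₗ[ℂ] Sh)

theorem lap_apply (f : Sh) :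
    lap f = partialD 0 0 (partialD 1 1 f) - partialD 0 1 (partialD 1 0 f) := rfl

theorem trPartial_apply (W : Matrix (Fin 2) (Fin 2) Sh) (f : Sh) :
    trPartial W f = W 0 0 * partialD 0 0 f + W 0 1 * partialD 0 1 f
      + (W 1 0 * partialD 1 0 f + W 1 1 * partialD 1 1 f) := by
  simp only [trPartial, Fin.sum_univ_two, Derivation.add_apply, Derivation.smul_apply, smul_eq_mul]

theorem quatD_apply (k : Fin 4) (f : Sh) :
    quatD k f = e k 0 0 • partialD 0 0 f + e k 0 1 • partialD 0 1 f
      + (e k 1 0 • partialD 1 0 f + e k 1 1 • partialD 1 1 f) := by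
  simp only [quatD, trPartial_apply, const_apply, Algebra.smul_def]

theorem algebraMap_I_sq : algebraMap ℂ Sh Complex.I * algebraMap ℂ Sh Complex.I = -1 := by
  rw [← map_mul, Complex.I_mul_I, map_neg, map_one]

theorem box_apply (f : Sh) : box f = 4 * lap f := by
  have h : box f = ∑ k, quatD k (quatD k f) := by
    simp only [box, LinearMap.sum_apply]
    rfl
  rw [h, lap_apply]
  simp only [Fin.sum_univ_four, quatD_apply, e, Matrix.cons_val_zero, Matrix.cons_val_one,
    Matrix.cons_val, Matrix.of_apply, Matrix.cons_val', Matrix.cons_val_fin_one, zero_smul,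
    one_smul, neg_smul, map_add, add_zero, zero_add, Derivation.map_smul]
  simp only [partialD_comm 1 1 0 0,
    partialD_comm 1 0 0 1, Algebra.smul_def]
  -- The factor collects exactly the second derivatives that carry a product `I * I`.
  linear_combination
    (partialD 0 1 (partialD 0 1 f) + 2 * partialD 0 1 (partialD 1 0 f)
      + partialD 1 0 (partialD 1 0 f) + partialD 0 0 (partialD 0 0 f)
      - 2 * partialD 0 0 (partialD 1 1 f) + partialD 1 1 (partialD 1 1 f)) * algebraMap_I_sq

/-- The operator `½ ∇` on columns. -/
def diracL : ShS →ₗ[ℂ] ShS where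
  toFun f i := partialD 0 i (f 0) + partialD 1 i (f 1)
  map_add' f g := by
    ext i
    simp only [Pi.add_apply, map_add]
    ring
  map_smul' c f := by
    ext i
    simp only [Pi.smul_apply, Derivation.map_smul, smul_add, RingHom.id_apply]

theorem diracL_apply (f : ShS) (i : Fin 2) :
    diracL f i = partialD 0 i (f 0) + partialD 1 i (f 1) := rfl

/-- The operator `½ ∇` on rows. -/
def diracR : ShS →ₗ[ℂ] ShS where
  toFun f i := partialD i 0 (f 0) + partialD i 1 (f 1)
  map_add' f g := by
    ext i
    simp only [Pi.add_apply, map_add]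
    ring
  map_smul' c f := by
    ext i
    simp only [Pi.smul_apply, Derivation.map_smul, smul_add, RingHom.id_apply]

theorem diracR_apply (f : ShS) (i : Fin 2) :
    diracR f i = partialD i 0 (f 0) + partialD i 1 (f 1) := rfl

theorem nablaL_apply (f : ShS) (i : Fin 2) : nablaL f i = 2 * diracL f i := by
  have h : nablaL f i = (const (e 0)).mulVec (fun j => quatD 0 (f j)) i
      - (const (e 1)).mulVec (fun j => quatD 1 (f j)) i
      - (const (e 2)).mulVec (fun j => quatD 2 (f j)) i
      - (const (e 3)).mulVec (fun j => quatD 3 (f j)) i := rfl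
  rw [h, diracL_apply]
  simp only [Matrix.mulVec, dotProduct, Fin.sum_univ_two, quatD_apply, const_apply]
  fin_cases i <;>
  simp only [e, Matrix.cons_val_zero, Matrix.cons_val_one,
    Matrix.cons_val, Matrix.of_apply, Matrix.cons_val', Matrix.cons_val_fin_one,
    map_neg, map_zero, map_one, add_zero, zero_add, Algebra.smul_def,
    Fin.zero_eta, Fin.mk_one, zero_mul, one_mul]
  · linear_combination (-(partialD 0 1 (f 1)) - partialD 1 0 (f 1) - partialD 0 0 (f 0)
      + partialD 1 1 (f 0)) * algebraMap_I_sq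
  · linear_combination (-(partialD 0 1 (f 0)) - partialD 1 0 (f 0) + partialD 0 0 (f 1)
      - partialD 1 1 (f 1)) * algebraMap_I_sq

theorem nablaR_apply (f : ShS) (i : Fin 2) : nablaR f i = 2 * diracR f i := by
  have h : nablaR f i = Matrix.vecMul (fun j => quatD 0 (f j)) (const (e 0)) i
      - Matrix.vecMul (fun j => quatD 1 (f j)) (const (e 1)) i
      - Matrix.vecMul (fun j => quatD 2 (f j)) (const (e 2)) i
      - Matrix.vecMul (fun j => quatD 3 (f j)) (const (e 3)) i := rfl
  rw [h, diracR_apply]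
  simp only [Matrix.vecMul, dotProduct, Fin.sum_univ_two, quatD_apply, const_apply]
  fin_cases i <;>
  simp only [e, Matrix.cons_val_zero, Matrix.cons_val_one,
    Matrix.cons_val, Matrix.of_apply, Matrix.cons_val', Matrix.cons_val_fin_one,
    map_neg, map_zero, map_one, add_zero, zero_add, Algebra.smul_def,
    Fin.zero_eta, Fin.mk_one, mul_zero, mul_one]
  · linear_combination (-(partialD 0 1 (f 1)) - partialD 1 0 (f 1) - partialD 0 0 (f 0)
      + partialD 1 1 (f 0)) * algebraMap_I_sq
  · linear_combination (-(partialD 0 1 (f 0)) - partialD 1 0 (f 0) + partialD 0 0 (f 1)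
      - partialD 1 1 (f 1)) * algebraMap_I_sq

theorem algebraMap_mul_eq_zero {c : ℂ} (hc : c ≠ 0) {f : Sh} (h : algebraMap ℂ Sh c * f = 0) :
    f = 0 := by
  rw [← Algebra.smul_def] at h
  exact (smul_eq_zero.mp h).resolve_left hc

/-- `□`, up to a factor, on pairs. -/
abbrev lap2 : ShS →ₗ[ℂ] ShS := compwise lap

theorem lap2_apply (f : ShS) (i : Fin 2) : lap2 f i = lap (f i) := rfl

theorem compwise_box (f : ShS) : compwise box f = (4 : ℂ) • lap2 f := by
  ext i
  have h : compwise box f i = box (f i) := rfl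
  rw [h, box_apply, Pi.smul_apply, Algebra.smul_def, map_ofNat, lap2_apply]

theorem mem_U_iff (f : ShS) : f ∈ U ↔ diracL (lap2 f) = 0 := by
  rw [U, LinearMap.mem_ker, LinearMap.comp_apply, compwise_box, map_smul]
  have h : nablaL (lap2 f) = (2 : ℂ) • diracL (lap2 f) := by
    ext i
    rw [nablaL_apply, Pi.smul_apply, Algebra.smul_def, map_ofNat]
  rw [h, smul_smul]
  exact smul_eq_zero_iff_right (by norm_num)

theorem mem_U'_iff (f : ShS) : f ∈ U' ↔ diracR (lap2 f) = 0 := by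
  rw [U', LinearMap.mem_ker, LinearMap.comp_apply, compwise_box, map_smul]
  have h : nablaR (lap2 f) = (2 : ℂ) • diracR (lap2 f) := by
    ext i
    rw [nablaR_apply, Pi.smul_apply, Algebra.smul_def, map_ofNat]
  rw [h, smul_smul]
  exact smul_eq_zero_iff_right (by norm_num)

/-! ### Homogeneity -/

theorem Z_mul_mem_shHomog (i j : Fin 2) {d d' : ℤ} {f : Sh} (hf : f ∈ shHomog d)
    (hd : d' = d + 1) : Z i j * f ∈ shHomog d' := by
  obtain ⟨n, k, p, hp, hn, h⟩ := hf
  refine ⟨1 + n, k, MvPolynomial.X (i, j) * p, (MvPolynomial.isHomogeneous_X ℂ (i, j)).mul hp,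
    by push_cast; omega, ?_⟩
  rw [mul_assoc, h, map_mul]
  rfl

theorem N_mul_mem_shHomog {d d' : ℤ} {f : Sh} (hf : f ∈ shHomog d) (hd : d' = d + 2) :
    N * f ∈ shHomog d' := by
  obtain ⟨n, k, p, hp, hn, h⟩ := hf
  refine ⟨2 + n, k, polyN * p, isHomogeneous_polyN.mul hp, by push_cast; omega, ?_⟩
  rw [mul_assoc, h, map_mul]
  rfl

/-- Quotient rule: `∂(p / N^k) = (N ∂p - k p ∂N) / N^(k+1)`, and both terms of the numerator have
degree `n + 1`. -/
theorem partialD_mem_shHomog (i j : Fin 2) {d d' : ℤ} {f : Sh} (hf : f ∈ shHomog d)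
    (hd : d' = d - 1) : partialD i j f ∈ shHomog d' := by
  obtain ⟨n, k, p, hp, hn, h⟩ := hf
  refine ⟨n + 1, k + 1, polyN * MvPolynomial.pderiv (i, j) p
    - (k : ℂ) • (p * MvPolynomial.pderiv (i, j) polyN), ?_, by push_cast; omega, ?_⟩
  · refine MvPolynomial.IsHomogeneous.sub ?_ ?_
    -- A constant `p` is treated apart: the degree `n - 1` of `∂p` is a truncated subtraction and
    -- would be wrong at `n = 0`.
    · obtain _ | m := n
      · have h0 : MvPolynomial.pderiv (i, j) p = 0 := by
          rw [← MvPolynomial.totalDegree_zero_iff_isHomogeneous,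
            MvPolynomial.totalDegree_eq_zero_iff_eq_C] at hp
          rw [hp, MvPolynomial.pderiv_C]
        rw [h0, mul_zero]
        exact MvPolynomial.isHomogeneous_zero _ _ _
      · have := isHomogeneous_polyN.mul (hp.pderiv (i := (i, j)))
        rwa [show 2 + (m + 1 - 1) = m + 1 + 1 by omega] at this
    · rw [MvPolynomial.smul_eq_C_mul]
      exact (hp.mul (isHomogeneous_polyN.pderiv (i := (i, j)))).C_mul _
  · have h1 := congrArg (partialD i j) h
    have h2 : algebraMap Poly Sh (MvPolynomial.pderiv (i, j) polyN) = partialD i j N :=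
      (partialD_algebraMap_poly i j polyN).symm
    have h3 : algebraMap Poly Sh polyN = N := rfl
    have h4 : algebraMap Poly Sh (MvPolynomial.C (k : ℂ)) = k := by simp
    rw [partialD_algebraMap_poly] at h1
    rw [map_sub, map_mul, ← h1, MvPolynomial.smul_eq_C_mul, map_mul (algebraMap Poly Sh),
      map_mul (algebraMap Poly Sh), ← h, h2, h3, h4,
      Derivation.leibniz, Derivation.leibniz_pow]
    simp only [smul_eq_mul, nsmul_eq_mul]
    rcases k with _ | k
    · simp
      ring
    · rw [Nat.add_sub_cancel]
      ring

/-- The Euler operator. -/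
def euler : Derivation ℂ Sh Sh := trPartial Z

theorem euler_apply (f : Sh) : euler f = Z 0 0 * partialD 0 0 f + Z 0 1 * partialD 0 1 f
      + (Z 1 0 * partialD 1 0 f + Z 1 1 * partialD 1 1 f) := trPartial_apply Z f

/-- Euler's identity for the polynomials `f N^k` and `N`; the product rule subtracts the
contribution `2k` of `N^k`, and the unit `N^k` is cancelled. -/
theorem euler_of_mem {d : ℤ} {f : Sh} (hf : f ∈ shHomog d) : euler f = d * f := by
  obtain ⟨n, k, p, hp, hn, h⟩ := hf
  have hpoly : ∀ {m : ℕ} {q : Poly}, q.IsHomogeneous m →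
      euler (algebraMap Poly Sh q) = m * algebraMap Poly Sh q := by
    intro m q hq
    have h1 := congrArg (algebraMap Poly Sh) hq.sum_X_mul_pderiv
    rw [map_sum, Fintype.sum_prod_type] at h1
    simp only [Fin.sum_univ_two, map_mul, ← partialD_algebraMap_poly, nsmul_eq_mul,
      map_natCast] at h1
    exact (euler_apply _).trans h1
  have h1 := congrArg euler h
  have h2 : euler N = 2 * N := hpoly isHomogeneous_polyN
  rw [hpoly hp, ← h, Derivation.leibniz, Derivation.leibniz_pow, h2] at h1
  have hn' : (n : Sh) = d + 2 * k := by exact_mod_cast congrArg (Int.cast : ℤ → Sh) hn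
  rw [hn'] at h1
  refine (isUnit_N.pow k).mul_left_cancel ?_
  simp only [smul_eq_mul, nsmul_eq_mul] at h1
  rcases k with _ | k
  · simpa using h1
  · rw [Nat.add_sub_cancel] at h1
    linear_combination h1

theorem mem_homog_iff {d : ℤ} {f : ShS} : f ∈ homog d ↔ ∀ i, f i ∈ shHomog d := by
  simp [homog, Submodule.mem_pi]

/-! ### The action of the four blocks of `gl(2, HC)` -/

theorem const_zero : const 0 = 0 := by
  ext i j
  simp [const_apply]

theorem field_translation (B : HC) : field !![0, B; 0, 0] = -const B := by
  simp [field, const_zero]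

theorem field_left (A : HC) : field !![A, 0; 0, 0] = -(const A * Z) := by
  simp [field, const_zero]

theorem field_right (D : HC) : field !![0, 0; 0, D] = Z * const D := by
  simp [field, const_zero]

theorem field_special (C : HC) : field !![0, 0; C, 0] = Z * const C * Z := by
  simp [field, const_zero]

theorem opL_translation (B : HC) (f : ShS) (i : Fin 2) :
    opL !![0, B; 0, 0] f i = -trPartial (const B) (f i) := by
  simp [opL_apply, field_translation, quotL, const_zero, trPartial_apply]
  ring

theorem opL_left (A : HC) (f : ShS) (i : Fin 2) :
    opL !![A, 0; 0, 0] f i = -trPartial (const A * Z) (f i)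
      + (const A i 0 * f 0 + const A i 1 * f 1 - (const A 0 0 + const A 1 1) * f i) := by
  simp [opL_apply, field_left, quotL, const_zero, trPartial_apply]
  ring

theorem opL_right (D : HC) (f : ShS) (i : Fin 2) :
    opL !![0, 0; 0, D] f i = trPartial (Z * const D) (f i) := by
  simp [opL_apply, field_right, quotL, const_zero]

theorem opL_special (C : HC) (f : ShS) (i : Fin 2) :
    opL !![0, 0; C, 0] f i = trPartial (Z * const C * Z) (f i)
      + (((Z * const C) 0 0 + (Z * const C) 1 1) * f i
        - ((Z * const C) i 0 * f 0 + (Z * const C) i 1 * f 1)) := by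
  simp [opL_apply, field_special, quotL, const_zero]
  ring

theorem opL_blocks (X : GLHC) (f : ShS) :
    opL X f = opL !![X 0 0, 0; 0, 0] f + opL !![0, X 0 1; 0, 0] f
      + opL !![0, 0; X 1 0, 0] f + opL !![0, 0; 0, X 1 1] f := by
  have h : X = !![X 0 0, 0; 0, 0] + !![0, X 0 1; 0, 0] + !![0, 0; X 1 0, 0]
      + !![0, 0; 0, X 1 1] := by
    ext i j : 2
    fin_cases i <;> fin_cases j <;> simp
  have h2 : ∀ X, opL X f = piL X f := fun _ => rfl
  simp only [h2]
  conv_lhs => rw [h]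
  simp only [map_add, LinearMap.add_apply]

/-! ### Invariance of `𝒰` -/

/-- This and the three identities after it are the intertwining property of `∇□`: in each the right
side involves `f` only through `diracL (lap2 f)`, so it vanishes when `∇□f` does. -/
theorem diracL_lap2_translation (B : HC) (f : ShS) (i : Fin 2) :
    diracL (lap2 (opL !![0, B; 0, 0] f)) i = -trPartial (const B) (diracL (lap2 f) i) := by
  simp only [diracL_apply, lap2_apply, lap_apply, opL_translation, trPartial_apply, const_apply,
    map_add, map_neg, map_sub, Derivation.leibniz, smul_eq_mul, partialD_algebraMap, mul_zero,
    map_zero]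
  obtain rfl | rfl : i = 0 ∨ i = 1 := by omega
  all_goals
    -- Mixed partials are sorted into one fixed order, so that `ring` can treat them as atoms.
    simp only [partialD_comm 0 1 0 0, partialD_comm 1 0 0 0, partialD_comm 1 1 0 0,
      partialD_comm 1 0 0 1, partialD_comm 1 1 0 1, partialD_comm 1 1 1 0]
    ring

theorem diracL_lap2_left (A : HC) (f : ShS) (i : Fin 2) :
    diracL (lap2 (opL !![A, 0; 0, 0] f)) i = -trPartial (const A * Z) (diracL (lap2 f) i)
      - 2 * (const A 0 0 + const A 1 1) * diracL (lap2 f) i := by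
  simp only [diracL_apply, lap2_apply, lap_apply, opL_left, trPartial_apply, const_apply,
    Matrix.mul_apply, Fin.sum_univ_two,
    map_add, map_neg, map_sub, Derivation.leibniz, smul_eq_mul, partialD_algebraMap, mul_zero]
  obtain rfl | rfl : i = 0 ∨ i = 1 := by omega
  all_goals
    simp [partialD_Z, -Fin.isValue]
    simp only [partialD_comm 0 1 0 0, partialD_comm 1 0 0 0, partialD_comm 1 1 0 0,
      partialD_comm 1 0 0 1, partialD_comm 1 1 0 1, partialD_comm 1 1 1 0]
    ring

theorem diracL_lap2_right (D : HC) (f : ShS) (i : Fin 2) :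
    diracL (lap2 (opL !![0, 0; 0, D] f)) i = trPartial (Z * const D) (diracL (lap2 f) i)
      + (const D i 0 * diracL (lap2 f) 0 + const D i 1 * diracL (lap2 f) 1
        + (const D 0 0 + const D 1 1) * diracL (lap2 f) i) := by
  simp only [diracL_apply, lap2_apply, lap_apply, opL_right, trPartial_apply, const_apply,
    Matrix.mul_apply, Fin.sum_univ_two,
    map_add, map_sub, Derivation.leibniz, smul_eq_mul, partialD_algebraMap, mul_zero]
  obtain rfl | rfl : i = 0 ∨ i = 1 := by omega
  all_goals
    simp [partialD_Z, -Fin.isValue]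
    simp only [partialD_comm 0 1 0 0, partialD_comm 1 0 0 0, partialD_comm 1 1 0 0,
      partialD_comm 1 0 0 1, partialD_comm 1 1 0 1, partialD_comm 1 1 1 0]
    ring

set_option maxHeartbeats 2000000 in
theorem diracL_lap2_special (C : HC) (f : ShS) (i : Fin 2) :
    diracL (lap2 (opL !![0, 0; C, 0] f)) i = trPartial (Z * const C * Z) (diracL (lap2 f) i)
      + ((const C * Z) i 0 * diracL (lap2 f) 0 + (const C * Z) i 1 * diracL (lap2 f) 1
        + 3 * ((const C * Z) 0 0 + (const C * Z) 1 1) * diracL (lap2 f) i) := by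
  simp only [diracL_apply, lap2_apply, lap_apply, opL_special, trPartial_apply, const_apply,
    Matrix.mul_apply, Fin.sum_univ_two,
    map_add, map_sub, Derivation.leibniz, smul_eq_mul, partialD_algebraMap, mul_zero]
  obtain rfl | rfl : i = 0 ∨ i = 1 := by omega
  all_goals
    simp [partialD_Z, -Fin.isValue]
    simp only [partialD_comm 0 1 0 0, partialD_comm 1 0 0 0, partialD_comm 1 1 0 0,
      partialD_comm 1 0 0 1, partialD_comm 1 1 0 1, partialD_comm 1 1 1 0]
    ring

theorem opL_mem_U (X : GLHC) {f : ShS} (hf : f ∈ U) : opL X f ∈ U := by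
  rw [mem_U_iff] at hf
  have h : ∀ i, diracL (lap2 f) i = 0 := fun i => by rw [hf, Pi.zero_apply]
  rw [opL_blocks]
  refine U.add_mem (U.add_mem (U.add_mem ?_ ?_) ?_) ?_ <;> rw [mem_U_iff] <;> ext i
  · simp [diracL_lap2_left, h]
  · simp [diracL_lap2_translation, h]
  · simp [diracL_lap2_special, h]
  · simp [diracL_lap2_right, h]

/-! ### The action and the grading -/

theorem algebraMap_mul_mem (c : ℂ) {d : ℤ} {f : Sh} (hf : f ∈ shHomog d) :
    algebraMap ℂ Sh c * f ∈ shHomog d := by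
  rw [← Algebra.smul_def]
  exact (shHomog d).smul_mem c hf

theorem opL_translation_mem_homog (B : HC) {d d' : ℤ} {f : ShS} (hf : f ∈ homog d)
    (hd : d' = d - 1) : opL !![0, B; 0, 0] f ∈ homog d' := by
  rw [mem_homog_iff] at hf ⊢
  intro i
  rw [opL_translation, trPartial_apply]
  simp only [const_apply]
  have h : ∀ k l, partialD k l (f i) ∈ shHomog d' := fun k l => partialD_mem_shHomog k l (hf i) hd
  exact Submodule.neg_mem _ (add_mem (add_mem (algebraMap_mul_mem _ (h _ _))
    (algebraMap_mul_mem _ (h _ _))) (add_mem (algebraMap_mul_mem _ (h _ _))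
    (algebraMap_mul_mem _ (h _ _))))

theorem Z_mul_partialD_mem {d : ℤ} {f : Sh} (hf : f ∈ shHomog d) (i j k l : Fin 2) :
    Z i j * partialD k l f ∈ shHomog d :=
  Z_mul_mem_shHomog i j (partialD_mem_shHomog k l hf rfl) (by omega)

theorem opL_left_mem_homog (A : HC) {d : ℤ} {f : ShS} (hf : f ∈ homog d) :
    opL !![A, 0; 0, 0] f ∈ homog d := by
  rw [mem_homog_iff] at hf ⊢
  intro i
  have h : ∀ c k l p q, algebraMap ℂ Sh c * Z k l * partialD p q (f i) ∈ shHomog d :=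
    fun c k l p q => by
      rw [mul_assoc]
      exact algebraMap_mul_mem _ (Z_mul_partialD_mem (hf i) _ _ _ _)
  simp only [opL_left, trPartial_apply, const_apply, Matrix.mul_apply, Fin.sum_univ_two, add_mul]
  exact add_mem (Submodule.neg_mem _ (add_mem (add_mem (add_mem (h ..) (h ..))
    (add_mem (h ..) (h ..))) (add_mem (add_mem (h ..) (h ..)) (add_mem (h ..) (h ..)))))
    (sub_mem (add_mem (algebraMap_mul_mem _ (hf _)) (algebraMap_mul_mem _ (hf _)))
      (add_mem (algebraMap_mul_mem _ (hf _)) (algebraMap_mul_mem _ (hf _))))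

theorem opL_right_mem_homog (D : HC) {d : ℤ} {f : ShS} (hf : f ∈ homog d) :
    opL !![0, 0; 0, D] f ∈ homog d := by
  rw [mem_homog_iff] at hf ⊢
  intro i
  have h : ∀ c k l p q, Z k l * algebraMap ℂ Sh c * partialD p q (f i) ∈ shHomog d :=
    fun c k l p q => by
      rw [mul_comm (Z k l), mul_assoc]
      exact algebraMap_mul_mem _ (Z_mul_partialD_mem (hf i) _ _ _ _)
  simp only [opL_right, trPartial_apply, const_apply, Matrix.mul_apply, Fin.sum_univ_two, add_mul]
  exact add_mem (add_mem (add_mem (h ..) (h ..))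
    (add_mem (h ..) (h ..))) (add_mem (add_mem (h ..) (h ..)) (add_mem (h ..) (h ..)))

theorem opL_special_mem_homog (C : HC) {d d' : ℤ} {f : ShS} (hf : f ∈ homog d)
    (hd : d' = d + 1) : opL !![0, 0; C, 0] f ∈ homog d' := by
  rw [mem_homog_iff] at hf ⊢
  intro i
  have h : ∀ c k l p q r s, Z k l * algebraMap ℂ Sh c * Z p q * partialD r s (f i)
      ∈ shHomog d' := fun c k l p q r s => by
    rw [mul_comm (Z k l), mul_assoc, mul_assoc]
    exact algebraMap_mul_mem _ (Z_mul_mem_shHomog _ _ (Z_mul_partialD_mem (hf i) _ _ _ _) hd)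
  have h2 : ∀ c k l i, Z k l * algebraMap ℂ Sh c * f i ∈ shHomog d' := fun c k l i => by
    rw [mul_comm (Z k l), mul_assoc]
    exact algebraMap_mul_mem _ (Z_mul_mem_shHomog _ _ (hf i) hd)
  simp only [opL_special, trPartial_apply, const_apply, Matrix.mul_apply, Fin.sum_univ_two,
    add_mul]
  have h4 : ∀ {a b c d : Sh}, a ∈ shHomog d' → b ∈ shHomog d' → c ∈ shHomog d' →
      d ∈ shHomog d' → a + b + (c + d) ∈ shHomog d' := fun ha hb hc hd =>
    add_mem (add_mem ha hb) (add_mem hc hd)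
  exact add_mem (add_mem (add_mem (h4 (h ..) (h ..) (h ..) (h ..))
    (h4 (h ..) (h ..) (h ..) (h ..))) (add_mem (h4 (h ..) (h ..) (h ..) (h ..))
    (h4 (h ..) (h ..) (h ..) (h ..))))
    (sub_mem (h4 (h2 ..) (h2 ..) (h2 ..) (h2 ..)) (h4 (h2 ..) (h2 ..) (h2 ..) (h2 ..)))

/-! ### Partial Casimir operators -/

/-- `∂_{ij}` on pairs. -/
abbrev partialD2 (i j : Fin 2) : ShS →ₗ[ℂ] ShS := compwise (partialD i j : Sh →ₗ[ℂ] Sh)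

theorem partialD2_apply (i j : Fin 2) (f : ShS) (k : Fin 2) :
    partialD2 i j f k = partialD i j (f k) := rfl

theorem partialD2_eq (i j : Fin 2) (f : ShS) :
    partialD2 i j f = -opL !![0, Matrix.single i j 1; 0, 0] f := by
  ext k
  rw [Pi.neg_apply, opL_translation, trPartial_apply, partialD2_apply]
  obtain rfl | rfl : i = 0 ∨ i = 1 := by omega
  all_goals
    obtain rfl | rfl : j = 0 ∨ j = 1 := by omega
    all_goals simp [const_apply]

/-- The special conformal transformation with `C` an elementary matrix. -/
def special (i j : Fin 2) : Module.End ℂ ShS := opL !![0, 0; Matrix.single i j 1, 0]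

theorem special_apply (i j : Fin 2) (f : ShS) (k : Fin 2) :
    special i j f k = Z 0 i * Z j 0 * partialD 0 0 (f k) + Z 0 i * Z j 1 * partialD 0 1 (f k)
      + (Z 1 i * Z j 0 * partialD 1 0 (f k) + Z 1 i * Z j 1 * partialD 1 1 (f k))
      + (Z j i * f k - Z k i * f j) := by
  rw [special, opL_special, trPartial_apply]
  simp only [Matrix.mul_apply, Fin.sum_univ_two, const_apply]
  obtain rfl | rfl : i = 0 ∨ i = 1 := by omega
  all_goals
    obtain rfl | rfl : j = 0 ∨ j = 1 := by omega
    all_goals simp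

/-- The transposed indices pair bases of the `C` and `B` blocks that are dual for the trace form,
which makes the sum a piece of the quadratic Casimir. Apart from the Euler operator only `N lap` and
`Z diracL` survive. -/
theorem sum_special_partialD (f : ShS) (a : Fin 2) :
    (∑ i, ∑ j, special i j (partialD2 j i f)) a = euler (euler (f a)) - 2 * N * lap (f a)
      - Z.mulVec (diracL f) a := by
  simp only [Fin.sum_univ_two, Pi.add_apply, special_apply, partialD2_apply, euler_apply,
    lap_apply, N_eq, Matrix.mulVec, dotProduct, diracL_apply, map_add, Derivation.leibniz,
    smul_eq_mul]
  simp [partialD_Z, -Fin.isValue]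
  simp only [partialD_comm 0 1 0 0, partialD_comm 1 0 0 0, partialD_comm 1 1 0 0,
      partialD_comm 1 0 0 1, partialD_comm 1 1 0 1, partialD_comm 1 1 1 0]
  obtain rfl | rfl : a = 0 ∨ a = 1 := by omega
  all_goals ring

theorem sum_partialD_special (f : ShS) (a : Fin 2) :
    (∑ i, ∑ j, partialD2 j i (special i j f)) a = euler (euler (f a)) + 4 * euler (f a) + 2 * f a
      - 2 * N * lap (f a) - Z.mulVec (diracL f) a := by
  simp only [Fin.sum_univ_two, Pi.add_apply, special_apply, partialD2_apply, euler_apply,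
    lap_apply, N_eq, Matrix.mulVec, dotProduct, diracL_apply, map_add, map_sub,
    Derivation.leibniz, smul_eq_mul]
  obtain rfl | rfl : a = 0 ∨ a = 1 := by omega
  all_goals
    simp [partialD_Z, -Fin.isValue]
    simp only [partialD_comm 0 1 0 0, partialD_comm 1 0 0 0, partialD_comm 1 1 0 0,
      partialD_comm 1 0 0 1, partialD_comm 1 1 0 1, partialD_comm 1 1 1 0]
    ring

/-! ### Commutation relations of `lap` and `½∇` with multiplication by `N` and `Z` -/

theorem lap_N_mul (f : Sh) : lap (N * f) = N * lap f + euler f + 2 * f := by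
  simp only [lap_apply, N_eq, euler_apply, map_add, map_sub, Derivation.leibniz, smul_eq_mul]
  simp [partialD_Z, -Fin.isValue]
  ring

theorem partialD_lap (i j : Fin 2) (f : Sh) : partialD i j (lap f) = lap (partialD i j f) := by
  simp only [lap_apply, map_sub, partialD_comm i j]

theorem diracL_lap2 (f : ShS) : diracL (lap2 f) = lap2 (diracL f) := by
  ext i
  simp only [diracL_apply, lap2_apply, partialD_lap, map_add]

/-- The operator `½∇` is a factor of the Laplacian: following it by the conjugate first-order
operator gives `lap` on each component. -/
theorem lap2_eq_zero_of_diracL {f : ShS} (hf : diracL f = 0) : lap2 f = 0 := by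
  have h0 : partialD 0 0 (f 0) + partialD 1 0 (f 1) = 0 := congrFun hf 0
  have h1 : partialD 0 1 (f 0) + partialD 1 1 (f 1) = 0 := congrFun hf 1
  have e1 := congrArg (partialD 1 1) h0
  have e2 := congrArg (partialD 1 0) h1
  have e3 := congrArg (partialD 0 0) h1
  have e4 := congrArg (partialD 0 1) h0
  simp only [map_add, map_zero] at e1 e2 e3 e4
  simp only [partialD_comm 0 1 0 0, partialD_comm 1 1 0 0,
      partialD_comm 1 0 0 1, partialD_comm 1 1 1 0] at e1 e2 e3 e4
  ext i
  obtain rfl | rfl : i = 0 ∨ i = 1 := by omega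
  · rw [lap2_apply, lap_apply, Pi.zero_apply]
    linear_combination e1 - e2
  · rw [lap2_apply, lap_apply, Pi.zero_apply]
    linear_combination e3 - e4

/-- The correction term is `adj(Z) f`, since the derivatives of `N = det Z` are the cofactors of
`Z`. -/
theorem diracL_N_smul (f : ShS) :
    diracL (N • f) = N • diracL f
      + ![Z 1 1 * f 0 - Z 0 1 * f 1, Z 0 0 * f 1 - Z 1 0 * f 0] := by
  ext i
  obtain rfl | rfl : i = 0 ∨ i = 1 := by omega
  all_goals
    simp only [diracL_apply, Pi.smul_apply, Pi.add_apply, N_eq, smul_eq_mul, map_sub,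
      Derivation.leibniz]
    simp [partialD_Z, -Fin.isValue]
    ring

/-- Only the term `adj(Z) f` of `diracL_N_smul` remains, and `Z adj(Z) = N`. -/
theorem mulVec_diracL_N_smul {f : ShS} (hf : diracL f = 0) :
    Z.mulVec (diracL (N • f)) = N • f := by
  rw [diracL_N_smul, hf, smul_zero, zero_add]
  ext i
  obtain rfl | rfl : i = 0 ∨ i = 1 := by omega
  all_goals
    simp [Matrix.mulVec, dotProduct, N_eq, -Fin.isValue]
    ring

/-- A curl-type compatibility condition: the conjugate operator applied to `diracL f` is `lap2 f`,
up to sign and order of the components. -/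
theorem partialD_diracL {f : ShS} (hf : lap2 f = 0) (j : Fin 2) :
    partialD j 1 (diracL f 0) = partialD j 0 (diracL f 1) := by
  have h0 : lap (f 0) = 0 := congrFun hf 0
  have h1 : lap (f 1) = 0 := congrFun hf 1
  rw [lap_apply] at h0 h1
  obtain rfl | rfl : j = 0 ∨ j = 1 := by omega
  all_goals
    simp only [diracL_apply, map_add]
    simp only [partialD_comm 0 1 0 0, partialD_comm 1 1 0 0,
      partialD_comm 1 0 0 1, partialD_comm 1 1 1 0]
  · linear_combination -h1
  · linear_combination h0

/-- Differentiating the entries of `Z` gives the factor 2; in the remaining terms `partialD_diracL`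
exchanges indices until they form the Euler operator. -/
theorem diracL_mulVec {f : ShS} (hf : lap2 f = 0) (i : Fin 2) :
    diracL (Z.mulVec (diracL f)) i = 2 * diracL f i + euler (diracL f i) := by
  have h0 := partialD_diracL hf 0
  have h1 := partialD_diracL hf 1
  generalize diracL f = g at *
  simp only [diracL_apply, Matrix.mulVec, dotProduct, Fin.sum_univ_two, map_add,
    Derivation.leibniz, smul_eq_mul, euler_apply]
  obtain rfl | rfl : i = 0 ∨ i = 1 := by omega
  all_goals simp [partialD_Z, -Fin.isValue]
  · linear_combination -Z 0 1 * h0 - Z 1 1 * h1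
  · linear_combination Z 0 0 * h0 + Z 1 0 * h1

/-- The cross terms, with one derivative on `Z` and one on `diracL f`, form the conjugate operator
applied to `diracL f`, which is `lap2 f`. -/
theorem lap2_mulVec (f : ShS) :
    lap2 (Z.mulVec (diracL f)) = Z.mulVec (diracL (lap2 f)) + lap2 f := by
  rw [diracL_lap2]
  ext i
  simp only [lap2_apply, Matrix.mulVec, dotProduct, Fin.sum_univ_two, Pi.add_apply, diracL_apply,
    lap_apply, map_add, Derivation.leibniz, smul_eq_mul]
  obtain rfl | rfl : i = 0 ∨ i = 1 := by omega
  all_goals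
    simp [partialD_Z, -Fin.isValue]
    simp only [partialD_comm 0 1 0 0, partialD_comm 1 0 0 0, partialD_comm 1 1 0 0,
      partialD_comm 1 0 0 1, partialD_comm 1 1 0 1, partialD_comm 1 1 1 0]
    ring

/-! ### Decomposition of the homogeneous components of `𝒰` -/

theorem mem_Udeg_iff {d : ℤ} {f : ShS} :
    f ∈ Udeg d ↔ diracL (lap2 f) = 0 ∧ ∀ i, f i ∈ shHomog d := by
  rw [Udeg, Submodule.mem_inf, mem_U_iff, mem_homog_iff]

theorem lap_mem_shHomog {d d' : ℤ} {f : Sh} (hf : f ∈ shHomog d) (hd : d' = d - 2) :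
    lap f ∈ shHomog d' := by
  rw [lap_apply]
  exact sub_mem (partialD_mem_shHomog _ _ (partialD_mem_shHomog _ _ hf rfl) (by omega))
    (partialD_mem_shHomog _ _ (partialD_mem_shHomog _ _ hf rfl) (by omega))

theorem diracL_mem_homog {d d' : ℤ} {f : ShS} (hf : f ∈ homog d) (hd : d' = d - 1) :
    diracL f ∈ homog d' := by
  rw [mem_homog_iff] at hf ⊢
  intro i
  exact add_mem (partialD_mem_shHomog _ _ (hf 0) hd) (partialD_mem_shHomog _ _ (hf 1) hd)

theorem mulVec_mem_homog {d d' : ℤ} {f : ShS} (hf : f ∈ homog d) (hd : d' = d + 1) :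
    Z.mulVec f ∈ homog d' := by
  rw [mem_homog_iff] at hf ⊢
  intro i
  simp only [Matrix.mulVec, dotProduct, Fin.sum_univ_two]
  exact add_mem (Z_mul_mem_shHomog _ _ (hf 0) hd) (Z_mul_mem_shHomog _ _ (hf 1) hd)

theorem lap2_N_smul {d : ℤ} {h : ShS} (hh : h ∈ homog d) (h0 : lap2 h = 0) :
    lap2 (N • h) = (d + 2 : ℂ) • h := by
  rw [mem_homog_iff] at hh
  ext i
  have h1 : lap (h i) = 0 := congrFun h0 i
  rw [lap2_apply, Pi.smul_apply, smul_eq_mul, lap_N_mul, h1, euler_of_mem (hh i), Pi.smul_apply,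
    Algebra.smul_def]
  simp only [map_add, map_ofNat, map_intCast]
  ring

theorem diracL_mulVec_diracL {d : ℤ} {f : ShS} (hf : f ∈ homog d) (h0 : lap2 f = 0) :
    diracL (Z.mulVec (diracL f)) = (d + 1 : ℂ) • diracL f := by
  have hg := diracL_mem_homog hf rfl
  rw [mem_homog_iff] at hg
  ext i
  rw [diracL_mulVec h0, euler_of_mem (hg i), Pi.smul_apply, Algebra.smul_def]
  simp only [map_add, map_one, map_intCast, Int.cast_sub, Int.cast_one]
  ring

/-- For `d ≠ 0`, the elements of `𝒰(d)` are harmonic up to a multiple of `N(Z)`. -/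
theorem lap2_sub_eq_zero {d : ℤ} (hd : d ≠ 0) {f : ShS} (hf : f ∈ Udeg d) :
    lap2 (f - (d : ℂ)⁻¹ • N • lap2 f) = 0 := by
  have hd' : (d : ℂ) ≠ 0 := by exact_mod_cast hd
  rw [mem_Udeg_iff] at hf
  have h1 : lap2 f ∈ homog (d - 2) := by
    rw [mem_homog_iff]
    exact fun i => lap_mem_shHomog (hf.2 i) rfl
  rw [map_sub, map_smul, lap2_N_smul h1 (lap2_eq_zero_of_diracL hf.1), smul_smul]
  push_cast
  rw [sub_add_cancel, inv_mul_cancel₀ hd', one_smul, sub_self]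

/-- Two successive projections. Since `lap2 f` is harmonic of degree `d - 2`, applying `lap2` to `N
lap2 f` gives `d lap2 f`, so `w = d⁻¹ N lap2 f` leaves a harmonic remainder `m`. On harmonic columns
of degree `d` the operator `Z diracL` satisfies `T² = (d + 1) T`, so `v = (d + 1)⁻¹ T m` is its
nonzero eigenpart and `u = m - v` lies in its kernel. The excluded degrees are those where a divisor
vanishes. -/
theorem Udeg_decomposition {d : ℤ} (hd : d ≠ 0) (hd1 : d ≠ -1) {f : ShS} (hf : f ∈ Udeg d) :
    ∃ u ∈ Udeg d, ∃ v ∈ Udeg d, ∃ w ∈ Udeg d, f = u + v + w ∧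
      (lap2 u = 0 ∧ Z.mulVec (diracL u) = 0) ∧
      (lap2 v = 0 ∧ Z.mulVec (diracL v) = (d + 1 : ℂ) • v) ∧
      (N • lap2 w = (d : ℂ) • w ∧ Z.mulVec (diracL w) = w) := by
  have hd' : (d : ℂ) ≠ 0 := by exact_mod_cast hd
  have hd1' : (d + 1 : ℂ) ≠ 0 := by
    have : d + 1 ≠ 0 := by omega
    exact_mod_cast this
  have hf' := hf
  rw [mem_Udeg_iff] at hf
  obtain ⟨h0, hh⟩ := hf
  have h1 : lap2 f ∈ homog (d - 2) := by
    rw [mem_homog_iff]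
    exact fun i => lap_mem_shHomog (hh i) rfl
  have hw0 : N • lap2 f ∈ homog d := by
    rw [mem_homog_iff] at h1 ⊢
    exact fun i => N_mul_mem_shHomog (h1 i) (by omega)
  have hlw : lap2 (N • lap2 f) = (d : ℂ) • lap2 f := by
    rw [lap2_N_smul h1 (lap2_eq_zero_of_diracL h0)]
    push_cast
    rw [sub_add_cancel]
  have hwU : N • lap2 f ∈ Udeg d := by
    rw [mem_Udeg_iff, ← mem_homog_iff]
    refine ⟨?_, hw0⟩
    rw [hlw, map_smul, h0, smul_zero]
  have hzero : ∀ g, g ∈ homog d → lap2 g = 0 → g ∈ Udeg d := fun g hg h => by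
    rw [mem_Udeg_iff, ← mem_homog_iff, h, map_zero]
    exact ⟨rfl, hg⟩
  have hl := lap2_sub_eq_zero hd hf'
  have hm : f - (d : ℂ)⁻¹ • N • lap2 f ∈ homog d :=
    sub_mem (mem_homog_iff.mpr hh) (Submodule.smul_mem _ _ hw0)
  have hZ := diracL_mulVec_diracL hm hl
  have hZl := lap2_mulVec (f - (d : ℂ)⁻¹ • N • lap2 f)
  rw [hl, map_zero, Matrix.mulVec_zero, add_zero] at hZl
  have hZm := mulVec_mem_homog (diracL_mem_homog hm rfl) (sub_add_cancel d 1).symm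
  have hfw : f = f - (d : ℂ)⁻¹ • N • lap2 f + (d : ℂ)⁻¹ • N • lap2 f := by abel
  generalize f - (d : ℂ)⁻¹ • N • lap2 f = m at *
  have hlv : lap2 ((d + 1 : ℂ)⁻¹ • Z.mulVec (diracL m)) = 0 := by
    rw [map_smul, hZl, smul_zero]
  have hv : (d + 1 : ℂ)⁻¹ • Z.mulVec (diracL m) ∈ homog d := Submodule.smul_mem _ _ hZm
  have hdv : diracL ((d + 1 : ℂ)⁻¹ • Z.mulVec (diracL m)) = diracL m := by
    rw [map_smul, hZ, smul_smul, inv_mul_cancel₀ hd1', one_smul]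
  refine ⟨m - (d + 1 : ℂ)⁻¹ • Z.mulVec (diracL m), ?_, (d + 1 : ℂ)⁻¹ • Z.mulVec (diracL m),
    hzero _ hv hlv, (d : ℂ)⁻¹ • N • lap2 f, Submodule.smul_mem _ _ hwU, ?_, ⟨?_, ?_⟩, ⟨hlv, ?_⟩,
    ?_, ?_⟩
  · refine hzero _ (sub_mem hm hv) ?_
    rw [map_sub, hl, hlv, sub_zero]
  · rw [sub_add_cancel]
    exact hfw
  · rw [map_sub, hl, hlv, sub_zero]
  · rw [map_sub, hdv, sub_self, Matrix.mulVec_zero]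
  · rw [hdv, smul_smul, mul_inv_cancel₀ hd1', one_smul]
  · rw [map_smul, hlw, smul_comm N, smul_comm N, smul_smul, smul_smul, mul_comm]
  · rw [map_smul, Matrix.mulVec_smul, mulVec_diracL_N_smul h0]

/-! ### Spectrum of the partial Casimir operators on `𝒰(d)` -/

theorem sum_special_partialD_of_mem {d : ℤ} {f : ShS} (hf : f ∈ homog d) :
    ∑ i, ∑ j, special i j (partialD2 j i f) = (d ^ 2 : ℂ) • f - (2 : ℂ) • N • lap2 f
      - Z.mulVec (diracL f) := by
  rw [mem_homog_iff] at hf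
  ext a
  have h2 : euler (d : Sh) = 0 := Derivation.map_intCast euler d
  rw [sum_special_partialD, euler_of_mem (hf a), Derivation.leibniz, euler_of_mem (hf a), h2]
  simp only [Pi.sub_apply, Pi.smul_apply]
  simp only [Algebra.smul_def, map_pow, map_intCast, map_ofNat,
    lap2_apply, mul_zero, Algebra.algebraMap_self_apply]
  ring

theorem sum_partialD_special_of_mem {d : ℤ} {f : ShS} (hf : f ∈ homog d) :
    ∑ i, ∑ j, partialD2 j i (special i j f) = (d ^ 2 + 4 * d + 2 : ℂ) • f
      - (2 : ℂ) • N • lap2 f - Z.mulVec (diracL f) := by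
  rw [mem_homog_iff] at hf
  ext a
  have h2 : euler (d : Sh) = 0 := Derivation.map_intCast euler d
  rw [sum_partialD_special, euler_of_mem (hf a), Derivation.leibniz, euler_of_mem (hf a), h2]
  simp only [Pi.sub_apply, Pi.smul_apply]
  simp only [Algebra.smul_def, map_pow, map_intCast, map_ofNat,
    lap2_apply, mul_zero, map_add, map_mul, Algebra.algebraMap_self_apply]
  ring

/-- If `c` differs from the eigenvalues of `2 N □ / 4 + Z ∂` on `𝒰(d)`, then the elements of `𝒰(d)`
lie in every subspace that contains their images under `c - 2 N □ / 4 - Z ∂`. -/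
theorem mem_of_shifted_mem {d : ℤ} (hd : d ≠ 0) (hd1 : d ≠ -1) {c : ℤ} (h0 : c ≠ 0)
    (h1 : c - (d + 1) ≠ 0) (h2 : c - 2 * d - 1 ≠ 0) {W : Submodule ℂ ShS}
    (hW : ∀ f ∈ Udeg d, (c : ℂ) • f - (2 : ℂ) • N • lap2 f - Z.mulVec (diracL f) ∈ W) :
    Udeg d ≤ W := by
  intro f hf
  obtain ⟨u, hu, v, hv, w, hw, rfl, ⟨hu1, hu2⟩, ⟨hv1, hv2⟩, hw1, hw2⟩ :=
    Udeg_decomposition hd hd1 hf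
  have key : ∀ {x : ℤ} {g : ShS}, x ≠ 0 → (x : ℂ) • g ∈ W → g ∈ W := fun hx hg =>
    (W.smul_mem_iff (by exact_mod_cast hx)).mp hg
  -- On `u`, `v`, `w` the shifted operator is the scalar `c`, `c - (d + 1)`, `c - 2d - 1`
  -- respectively.
  refine add_mem (add_mem (key h0 ?_) (key h1 ?_)) (key h2 ?_)
  · simpa [hu1, hu2] using hW u hu
  · have := hW v hv
    rw [hv1, hv2, smul_zero, smul_zero, sub_zero, ← sub_smul] at this
    exact_mod_cast this
  · have := hW w hw
    rw [hw1, hw2, smul_smul, ← sub_smul] at this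
    nth_rewrite 2 [← one_smul ℂ w] at this
    rw [← sub_smul] at this
    exact_mod_cast this

theorem Udeg_le_of_partialD {d : ℤ} (hd : 1 ≤ d) {W : Submodule ℂ ShS}
    (hW : ∀ f ∈ Udeg d, ∀ i j, special i j (partialD2 j i f) ∈ W) : Udeg d ≤ W := by
  have h5 : d ^ 2 - (d + 1) ≠ 0 := by
    intro h
    -- The quadratics `d² - d - 1` and `d² - 2d - 1` have irrational roots; each case split brackets
    -- the positive root between consecutive integers.
    obtain h3 | h3 : d ≤ 1 ∨ 2 ≤ d := by omega
    · nlinarith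
    · nlinarith
  have h8 : d ^ 2 - 2 * d - 1 ≠ 0 := by
    intro h
    obtain h3 | h3 : d ≤ 2 ∨ 3 ≤ d := by omega
    · nlinarith
    · nlinarith
  refine mem_of_shifted_mem (c := d ^ 2) (by omega) (by omega) (by positivity) h5 h8 ?_
  intro f hf
  have h := sum_special_partialD_of_mem hf.2
  push_cast
  rw [← h]
  exact sum_mem fun i _ => sum_mem fun j _ => hW f hf i j

/-- The first two values are quadratics with irrational roots, and the third equals `(d + 1)²`,
whose root `-1` is excluded. -/
theorem eigenvalues_ne_zero {d : ℤ} (hd : d ≤ -2) : d ^ 2 + 4 * d + 2 ≠ 0 ∧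
    d ^ 2 + 4 * d + 2 - (d + 1) ≠ 0 ∧ d ^ 2 + 4 * d + 2 - 2 * d - 1 ≠ 0 := by
  refine ⟨fun h => ?_, fun h => ?_, fun h => ?_⟩
  · obtain h3 | h3 : d ≤ -4 ∨ -3 ≤ d := by omega
    · nlinarith
    · nlinarith
  · obtain h3 | h3 : d ≤ -3 ∨ -2 ≤ d := by omega
    · nlinarith
    · nlinarith
  · nlinarith

theorem Udeg_le_of_special {d : ℤ} (hd : d ≤ -2) {W : Submodule ℂ ShS}
    (hW : ∀ f ∈ Udeg d, ∀ i j, partialD2 j i (special i j f) ∈ W) : Udeg d ≤ W := by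
  obtain ⟨h2, h5, h8⟩ := eigenvalues_ne_zero hd
  refine mem_of_shifted_mem (by omega) (by omega) h2 h5 h8 ?_
  intro f hf
  have h := sum_partialD_special_of_mem hf.2
  push_cast
  rw [← h]
  exact sum_mem fun i _ => sum_mem fun j _ => hW f hf i j

/-- The hypothesis gives `c f = 2 N lap2 f + Z diracL f` with `c = d² + 4d + 2`. Applying `lap2`
yields `(c - 2d - 1) lap2 f = 0`, then applying `diracL` yields `(c - d - 1) diracL f = 0`, and
finally `c f = 0`. As only one vector is known to be killed, `mem_of_shifted_mem` does not apply. -/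
theorem eq_zero_of_special {d : ℤ} (hd : d ≤ -2) {f : ShS} (hf : f ∈ Udeg d)
    (h : ∀ i j, special i j f = 0) : f = 0 := by
  obtain ⟨h2, h5, h8⟩ := eigenvalues_ne_zero hd
  have hT := sum_partialD_special_of_mem hf.2
  simp only [h, map_zero, Finset.sum_const_zero] at hT
  have hU := hf
  rw [mem_Udeg_iff] at hf
  have hl : lap2 f ∈ homog (d - 2) := by
    rw [mem_homog_iff]
    exact fun i => lap_mem_shHomog (hf.2 i) rfl
  have hl0 : lap2 f = 0 := by
    have h1 := congrArg lap2 hT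
    rw [map_sub, map_sub, map_smul, map_smul, lap2_N_smul hl (lap2_eq_zero_of_diracL hf.1),
      lap2_mulVec, hf.1, Matrix.mulVec_zero, map_zero, zero_add, smul_smul, ← sub_smul] at h1
    nth_rewrite 2 [← one_smul ℂ (lap2 f)] at h1
    rw [← sub_smul, eq_comm, smul_eq_zero] at h1
    refine h1.resolve_left fun h3 => h8 ?_
    push_cast at h3
    have h4 : ((d ^ 2 + 4 * d + 2 - 2 * d - 1 : ℤ) : ℂ) = 0 := by
      push_cast
      linear_combination h3
    exact_mod_cast h4
  rw [hl0, smul_zero, smul_zero, sub_zero] at hT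
  have hg : diracL f = 0 := by
    have h1 := congrArg diracL hT
    rw [map_sub, map_smul, diracL_mulVec_diracL hU.2 hl0, ← sub_smul, map_zero, eq_comm,
      smul_eq_zero] at h1
    exact h1.resolve_left fun h3 => h5 (by exact_mod_cast h3)
  rw [hg, Matrix.mulVec_zero, sub_zero, eq_comm, smul_eq_zero] at hT
  exact hT.resolve_left fun h3 => h2 (by exact_mod_cast h3)

/-- Euler's identity reduces to `d f = 0`. -/
theorem eq_zero_of_partialD {d : ℤ} (hd : d ≠ 0) {f : ShS} (hf : f ∈ Udeg d)
    (h : ∀ i j, partialD2 i j f = 0) : f = 0 := by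
  rw [mem_Udeg_iff] at hf
  ext a
  have h1 := euler_of_mem (hf.2 a)
  have h2 : ∀ i j, partialD i j (f a) = 0 := fun i j => congrFun (h i j) a
  simp only [euler_apply, h2, mul_zero, add_zero] at h1
  have h3 : algebraMap ℂ Sh d * f a = 0 := by
    rw [map_intCast, ← h1]
  exact algebraMap_mul_eq_zero (by exact_mod_cast hd) h3

/-! ### Harmonic elements of `Sh` -/

theorem euler_N : euler N = 2 * N := by
  have h : N ∈ shHomog 2 := ⟨2, 0, polyN, isHomogeneous_polyN, by norm_num, by
    rw [pow_zero, mul_one]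
    rfl⟩
  have := euler_of_mem h
  exact_mod_cast this

theorem euler_N_pow_mul {d : ℤ} {f : Sh} (hf : f ∈ shHomog d) (k : ℕ) :
    euler (N ^ k * f) = (d + 2 * k) * (N ^ k * f) := by
  rw [Derivation.leibniz, Derivation.leibniz_pow, euler_N, euler_of_mem hf]
  simp only [smul_eq_mul, nsmul_eq_mul]
  rcases k with _ | k
  · simp
  · rw [Nat.add_sub_cancel]
    push_cast
    ring

theorem lap_N_pow_mul {d : ℤ} {f : Sh} (hf : f ∈ shHomog d) (k : ℕ) :
    lap (N ^ (k + 1) * f)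
      = N ^ (k + 1) * lap f + ((k + 1) * (k + 2 + d) : ℤ) * (N ^ k * f) := by
  induction k with
  | zero =>
    rw [zero_add, pow_one, lap_N_mul, euler_of_mem hf]
    push_cast
    ring
  | succ k ih =>
    rw [pow_succ' N (k + 1), mul_assoc, lap_N_mul, ih, euler_N_pow_mul hf]
    push_cast
    ring

theorem algebraMap_poly_smul (c : ℂ) (p : Poly) :
    algebraMap Poly Sh (c • p) = c • algebraMap Poly Sh p := by
  rw [Algebra.smul_def, map_mul, ← IsScalarTower.algebraMap_apply, ← Algebra.smul_def]

/-- A bound on the pole of a harmonic function along `N = 0`. By `lap_N_pow_mul`, `lap` sends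
`N^(r+1) f` to `(r+1)(r+2+d) N^r f`, so as long as the factor is nonzero, polynomiality of `N^(r+1)
f` passes to `N^r f`. The hypothesis `hm` keeps `r + 2 + d` positive for all `r ≥ m`. -/
theorem harmonic_mul_N_pow {d : ℤ} {f : Sh} (hf : f ∈ shHomog d) (h0 : lap f = 0) {m n : ℕ}
    (hm : 0 ≤ m + 1 + d) (hn : (n : ℤ) = d + 2 * m) :
    ∃ p : Poly, p.IsHomogeneous n ∧ N ^ m * f = algebraMap Poly Sh p := by
  have key : ∀ (j : ℕ) (p : Poly), p.IsHomogeneous (n + 2 * j) →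
      N ^ (m + j) * f = algebraMap Poly Sh p →
      ∃ p : Poly, p.IsHomogeneous n ∧ N ^ m * f = algebraMap Poly Sh p := by
    intro j
    induction j with
    | zero => exact fun p hp h => ⟨p, hp, h⟩
    | succ j ih =>
      intro p hp h
      have hc : ((m + j : ℕ) + 1) * ((m + j : ℕ) + 2 + d) ≠ 0 := by
        refine mul_ne_zero (by omega) ?_
        push_cast
        omega
      have hl := lap_N_pow_mul hf (m + j)
      rw [h0, mul_zero, zero_add, add_assoc, h, lap_apply] at hl
      simp only [partialD_algebraMap_poly] at hl
      rw [← map_sub] at hl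
      generalize ((m + j : ℕ) + 1) * ((m + j : ℕ) + 2 + d) = c at hc hl
      refine ih ((c : ℂ)⁻¹ • (MvPolynomial.pderiv (0, 0) (MvPolynomial.pderiv (1, 1) p)
        - MvPolynomial.pderiv (0, 1) (MvPolynomial.pderiv (1, 0) p))) ?_ ?_
      · rw [MvPolynomial.smul_eq_C_mul]
        have h1 := (hp.pderiv (i := (1, 1))).pderiv (i := (0, 0))
        have h2 := (hp.pderiv (i := (1, 0))).pderiv (i := (0, 1))
        exact (h1.sub h2).C_mul _
      · have hc' : (c : ℂ) ≠ 0 := by exact_mod_cast hc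
        have h3 : algebraMap ℂ Sh c = c := map_intCast _ _
        rw [algebraMap_poly_smul, hl, ← h3, ← Algebra.smul_def, smul_smul, inv_mul_cancel₀ hc',
          one_smul]
  obtain ⟨n', k, p, hp, hn', h⟩ := hf
  refine key k (polyN ^ m * p) ?_ ?_
  · have h1 := (isHomogeneous_polyN.pow m).mul hp
    rwa [show 2 * m + n' = n + 2 * k by omega] at h1
  · rw [map_mul, map_pow, ← h, pow_add]
    change _ = N ^ m * _
    ring

theorem homogeneous_zero {p : Poly} (hp : p.IsHomogeneous 0) :
    ∃ c : ℂ, algebraMap Poly Sh p = algebraMap ℂ Sh c := by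
  rw [← MvPolynomial.totalDegree_zero_iff_isHomogeneous,
    MvPolynomial.totalDegree_eq_zero_iff_eq_C] at hp
  refine ⟨p.coeff 0, ?_⟩
  conv_lhs => rw [hp]
  rw [← MvPolynomial.algebraMap_eq, ← IsScalarTower.algebraMap_apply]

theorem harmonic_zero {f : Sh} (hf : f ∈ shHomog 0) (h0 : lap f = 0) :
    ∃ c : ℂ, f = algebraMap ℂ Sh c := by
  obtain ⟨p, hp, h⟩ := harmonic_mul_N_pow (m := 0) (n := 0) hf h0 (by norm_num) (by norm_num)
  obtain ⟨c, hc⟩ := homogeneous_zero hp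
  exact ⟨c, by rw [← hc, ← h, pow_zero, one_mul]⟩

/-- Here `N f` is a linear form, so `lap (N f) = 0`; but the commutation relation gives `lap (N f) =
f` in degree `-1`. -/
theorem harmonic_neg_one {f : Sh} (hf : f ∈ shHomog (-1)) (h0 : lap f = 0) : f = 0 := by
  obtain ⟨p, hp, h⟩ := harmonic_mul_N_pow (m := 1) (n := 1) hf h0 (by norm_num) (by norm_num)
  have h1 := lap_N_pow_mul hf 0
  have hd : ∀ i j, partialD 0 i (partialD 1 j (algebraMap Poly Sh p)) = 0 := by
    intro i j
    rw [partialD_algebraMap_poly]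
    obtain ⟨c, hc⟩ := homogeneous_zero (hp.pderiv (i := (1, j)))
    rw [hc, partialD_algebraMap]
  rw [zero_add, h, lap_apply, hd, hd, h0] at h1
  simpa using h1.symm

theorem harmonic_neg_two {f : Sh} (hf : f ∈ shHomog (-2)) (h0 : lap f = 0) :
    ∃ c : ℂ, N * f = algebraMap ℂ Sh c := by
  obtain ⟨p, hp, h⟩ := harmonic_mul_N_pow (m := 1) (n := 0) hf h0 (by norm_num) (by norm_num)
  obtain ⟨c, hc⟩ := homogeneous_zero hp
  exact ⟨c, by rw [← hc, ← h, pow_one]⟩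

theorem harmonic_neg_three {f : Sh} (hf : f ∈ shHomog (-3)) (h0 : lap f = 0) :
    ∀ i j, ∃ c : ℂ, partialD i j (N * (N * f)) = algebraMap ℂ Sh c := by
  obtain ⟨p, hp, h⟩ := harmonic_mul_N_pow (m := 2) (n := 1) hf h0 (by norm_num) (by norm_num)
  intro i j
  obtain ⟨c, hc⟩ := homogeneous_zero (hp.pderiv (i := (i, j)))
  refine ⟨c, ?_⟩
  rw [← hc, ← mul_assoc, ← pow_two, h, partialD_algebraMap_poly]

/-! ### The components `𝒰(0)` and `𝒰(-1)` -/

/-- The constant columns. -/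
def constS : (Fin 2 → ℂ) →ₗ[ℂ] ShS where
  toFun c i := algebraMap ℂ Sh (c i)
  map_add' b c := by
    ext i
    simp
  map_smul' a c := by
    ext i
    simp [Algebra.smul_def]

theorem constS_apply (c : Fin 2 → ℂ) (i : Fin 2) : constS c i = algebraMap ℂ Sh (c i) := rfl

/-- The columns `N(Z)⁻¹ Z c`. -/
def invS (c : Fin 2 → ℂ) : ShS := (↑(isUnit_N.unit⁻¹) : Sh) • Z.mulVec (constS c)

theorem N_smul_invS (c : Fin 2 → ℂ) : N • invS c = Z.mulVec (constS c) := by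
  rw [invS, smul_smul, IsUnit.mul_val_inv, one_smul]

theorem N_smul_cancel {f g : ShS} (h : N • f = N • g) : f = g := by
  ext i
  exact isUnit_N.mul_left_cancel (congrFun h i)

/-- The column `lap2 f` is harmonic of degree `-2`, so `N lap2 f` is constant and `diracL` kills it.
The product rule then leaves `adj(Z) lap2 f = 0`, whence `lap2 f = 0` because `N` is invertible. A
harmonic `f` of degree 0 is constant. -/
theorem mem_Udeg_zero {f : ShS} (hf : f ∈ Udeg 0) : ∃ c, f = constS c := by
  rw [mem_Udeg_iff] at hf
  obtain ⟨hd, hf⟩ := hf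
  have hl : ∀ i, lap (lap (f i)) = 0 := fun i => congrFun (lap2_eq_zero_of_diracL hd) i
  have hmem : ∀ i, lap (f i) ∈ shHomog (-2) := fun i => lap_mem_shHomog (hf i) (by norm_num)
  obtain ⟨c0, h0⟩ := harmonic_neg_two (hmem 0) (hl 0)
  obtain ⟨c1, h1⟩ := harmonic_neg_two (hmem 1) (hl 1)
  have hN := diracL_N_smul (lap2 f)
  have hz : diracL (N • lap2 f) = 0 := by
    ext i
    rw [diracL_apply, Pi.smul_apply, Pi.smul_apply, smul_eq_mul, smul_eq_mul, lap2_apply,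
      lap2_apply, h0, h1, partialD_algebraMap, partialD_algebraMap, add_zero, Pi.zero_apply]
  rw [hz, hd, smul_zero, zero_add] at hN
  have e0 : 0 = Z 1 1 * lap (f 0) - Z 0 1 * lap (f 1) := congrFun hN 0
  have e1 : 0 = Z 0 0 * lap (f 1) - Z 1 0 * lap (f 0) := congrFun hN 1
  have hh : ∀ i, lap (f i) = 0 := by
    intro i
    apply isUnit_N.mul_left_cancel
    rw [mul_zero, N_eq]
    obtain rfl | rfl : i = 0 ∨ i = 1 := by omega
    · linear_combination -Z 0 0 * e0 - Z 0 1 * e1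
    · linear_combination -Z 1 0 * e0 - Z 1 1 * e1
  choose c hc using fun i => harmonic_zero (hf i) (hh i)
  exact ⟨c, funext hc⟩

/-- The column `f + N lap2 f` is harmonic of degree `-1`, hence zero. So `N f = -N² lap2 f` has
constant derivatives, and `k = diracL (N f)` is a constant column. The product rule for `N f` gives
`k = N diracL f + adj(Z) f`, and the one for `N lap2 f = -f` gives `N diracL f = adj(Z) f`.
Therefore `k = 2 adj(Z) f`, and multiplying by `Z` yields `2 N f = Z k`. -/
theorem mem_Udeg_neg_one {f : ShS} (hf : f ∈ Udeg (-1)) : ∃ c, f = invS c := by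
  have hf0 := lap2_sub_eq_zero (by norm_num) hf
  rw [mem_Udeg_iff] at hf
  obtain ⟨hd, hf⟩ := hf
  have hl : ∀ i, lap (lap (f i)) = 0 := fun i => congrFun (lap2_eq_zero_of_diracL hd) i
  have hmem : ∀ i, lap (f i) ∈ shHomog (-3) := fun i => lap_mem_shHomog (hf i) (by norm_num)
  have hfh : f = -(N • lap2 f) := by
    have h : f - ((-1 : ℤ) : ℂ)⁻¹ • N • lap2 f = f + N • lap2 f := by
      push_cast
      rw [inv_neg, inv_one, neg_one_smul, sub_neg_eq_add]
    rw [h] at hf0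
    rw [eq_neg_iff_add_eq_zero]
    ext i
    refine harmonic_neg_one ?_ (congrFun hf0 i)
    exact add_mem (hf i) (N_mul_mem_shHomog (hmem i) (by norm_num))
  choose c hc using fun i => harmonic_neg_three (hmem i) (hl i)
  have hk : diracL (N • f) = constS fun i => -(c 0 0 i + c 1 1 i) := by
    ext i
    rw [hfh, diracL_apply, constS_apply, map_neg, map_add, ← hc, ← hc]
    simp only [Pi.smul_apply, Pi.neg_apply, smul_eq_mul, mul_neg, map_neg, lap2_apply]
    ring
  have h1 := diracL_N_smul f
  have h2 := diracL_N_smul (lap2 f)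
  rw [hd, smul_zero, zero_add] at h2
  have h3 : diracL (N • lap2 f) = -diracL f := by
    conv_rhs => rw [hfh, map_neg, neg_neg]
  rw [hk] at h1
  rw [h3] at h2
  generalize (fun i => -(c 0 0 i + c 1 1 i)) = k at h1
  have f0 : f 0 = -(N * lap (f 0)) := congrFun hfh 0
  have f1 : f 1 = -(N * lap (f 1)) := congrFun hfh 1
  have p0 : constS k 0 = N * diracL f 0 + (Z 1 1 * f 0 - Z 0 1 * f 1) := congrFun h1 0
  have p1 : constS k 1 = N * diracL f 1 + (Z 0 0 * f 1 - Z 1 0 * f 0) := congrFun h1 1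
  have q0 : -diracL f 0 = Z 1 1 * lap (f 0) - Z 0 1 * lap (f 1) := congrFun h2 0
  have q1 : -diracL f 1 = Z 0 0 * lap (f 1) - Z 1 0 * lap (f 0) := congrFun h2 1
  refine ⟨(2 : ℂ)⁻¹ • k, N_smul_cancel ?_⟩
  rw [N_smul_invS, map_smul, Matrix.mulVec_smul]
  have h4 : (2 : ℂ) • N • f = Z.mulVec (constS k) := by
    ext i
    simp only [Matrix.mulVec, dotProduct, Fin.sum_univ_two, p0, p1, Pi.smul_apply]
    simp only [Algebra.smul_def, map_ofNat, Algebra.algebraMap_self_apply]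
    have r0 : N * diracL f 0 = Z 1 1 * f 0 - Z 0 1 * f 1 := by
      linear_combination -N * q0 - Z 1 1 * f0 + Z 0 1 * f1
    have r1 : N * diracL f 1 = Z 0 0 * f 1 - Z 1 0 * f 0 := by
      linear_combination -N * q1 - Z 0 0 * f1 + Z 1 0 * f0
    rw [r0, r1, N_eq]
    obtain rfl | rfl : i = 0 ∨ i = 1 := by omega
    · ring
    · ring
  rw [← h4, smul_smul, inv_mul_cancel₀ two_ne_zero, one_smul]

theorem N_mul_partialD_invS (c : Fin 2 → ℂ) (i j k : Fin 2) :
    N * partialD i j (invS c k)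
      = partialD i j (Z.mulVec (constS c) k) - partialD i j N * invS c k := by
  have h : N * invS c k = Z.mulVec (constS c) k := congrFun (N_smul_invS c) k
  have h2 := congrArg (partialD i j) h
  rw [Derivation.leibniz, smul_eq_mul, smul_eq_mul] at h2
  linear_combination h2

/-- Conceptually, the inversion `Z ↦ Z⁻¹` turns constants into these columns and translations into
special conformal transformations. The verification clears the denominator `N` and uses the product
rule for `N * invS c`. -/
theorem special_invS (c : Fin 2 → ℂ) (i j : Fin 2) : special i j (invS c) = 0 := by
  apply N_smul_cancel
  rw [smul_zero]
  ext k
  have h0 : N * invS c 0 = Z.mulVec (constS c) 0 := congrFun (N_smul_invS c) 0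
  have h1 : N * invS c 1 = Z.mulVec (constS c) 1 := congrFun (N_smul_invS c) 1
  have hD := N_mul_partialD_invS c
  have hd : ∀ i j k, partialD i j (constS c k) = 0 := fun i j k => partialD_algebraMap i j _
  rw [Pi.smul_apply, smul_eq_mul, special_apply, Pi.zero_apply]
  simp only [Matrix.mulVec, dotProduct, Fin.sum_univ_two, map_add, Derivation.leibniz, hd,
    smul_eq_mul, mul_zero, zero_add] at h0 h1 hD
  have e1 := hD 0 0 k
  have e2 := hD 0 1 k
  have e3 := hD 1 0 k
  have e4 := hD 1 1 k
  rw [N_eq] at *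
  simp only [map_sub, Derivation.leibniz, smul_eq_mul] at e1 e2 e3 e4
  obtain rfl | rfl : k = 0 ∨ k = 1 := by omega
  all_goals
    obtain rfl | rfl : i = 0 ∨ i = 1 := by omega
    all_goals
      obtain rfl | rfl : j = 0 ∨ j = 1 := by omega
      all_goals simp [partialD_Z, -Fin.isValue] at e1 e2 e3 e4
  · linear_combination Z 0 0 * Z 0 0 * e1 + Z 0 0 * Z 0 1 * e2 + Z 1 0 * Z 0 0 * e3
      + Z 1 0 * Z 0 1 * e4 - Z 0 0 * h0
  · linear_combination Z 0 0 * Z 1 0 * e1 + Z 0 0 * Z 1 1 * e2 + Z 1 0 * Z 1 0 * e3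
      + Z 1 0 * Z 1 1 * e4 - Z 0 0 * h1
  · linear_combination Z 0 1 * Z 0 0 * e1 + Z 0 1 * Z 0 1 * e2 + Z 1 1 * Z 0 0 * e3
      + Z 1 1 * Z 0 1 * e4 - Z 0 1 * h0
  · linear_combination Z 0 1 * Z 1 0 * e1 + Z 0 1 * Z 1 1 * e2 + Z 1 1 * Z 1 0 * e3
      + Z 1 1 * Z 1 1 * e4 - Z 0 1 * h1
  · linear_combination Z 0 0 * Z 0 0 * e1 + Z 0 0 * Z 0 1 * e2 + Z 1 0 * Z 0 0 * e3
      + Z 1 0 * Z 0 1 * e4 - Z 1 0 * h0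
  · linear_combination Z 0 0 * Z 1 0 * e1 + Z 0 0 * Z 1 1 * e2 + Z 1 0 * Z 1 0 * e3
      + Z 1 0 * Z 1 1 * e4 - Z 1 0 * h1
  · linear_combination Z 0 1 * Z 0 0 * e1 + Z 0 1 * Z 0 1 * e2 + Z 1 1 * Z 0 0 * e3
      + Z 1 1 * Z 0 1 * e4 - Z 1 1 * h0
  · linear_combination Z 0 1 * Z 1 0 * e1 + Z 0 1 * Z 1 1 * e2 + Z 1 1 * Z 1 0 * e3
      + Z 1 1 * Z 1 1 * e4 - Z 1 1 * h1

theorem opL_special_invS (C : HC) (c : Fin 2 → ℂ) : opL !![0, 0; C, 0] (invS c) = 0 := by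
  have h : opL !![0, 0; C, 0] (invS c) = ∑ i, ∑ j, C i j • special i j (invS c) := by
    ext k
    simp only [Fin.sum_univ_two, Pi.add_apply, Pi.smul_apply]
    simp only [special_apply, Algebra.smul_def, opL_special, trPartial_apply, Matrix.mul_apply,
      Fin.sum_univ_two, const_apply]
    ring
  rw [h]
  simp [special_invS]

theorem opL_translation_constS (B : HC) (c : Fin 2 → ℂ) :
    opL !![0, B; 0, 0] (constS c) = 0 := by
  ext i
  simp [opL_translation, constS_apply]

theorem algebraMap_mem_shHomog (c : ℂ) : algebraMap ℂ Sh c ∈ shHomog 0 :=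
  ⟨0, 0, MvPolynomial.C c, MvPolynomial.isHomogeneous_C _ _, by norm_num, by
    rw [pow_zero, mul_one, ← MvPolynomial.algebraMap_eq, ← IsScalarTower.algebraMap_apply]⟩

theorem constS_mem (c : Fin 2 → ℂ) : constS c ∈ Udeg 0 := by
  rw [mem_Udeg_iff]
  refine ⟨?_, fun i => algebraMap_mem_shHomog (c i)⟩
  have h : lap2 (constS c) = 0 := by
    ext i
    rw [lap2_apply, constS_apply, lap_apply]
    simp []
  rw [h, map_zero]

/-- Needed to see that `𝒰⁻` is nonzero. With `f = invS c`, harmonicity of `N f = Z c` gives `N lap2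
f = -f`, while `adj(Z) f = c` and `diracL (Z c) = 2c` give `N diracL f = c`. Inserting these in the
product rule for `N lap2 f` leaves `N² diracL (lap2 f) = 0`. -/
theorem invS_mem (c : Fin 2 → ℂ) : invS c ∈ Udeg (-1) := by
  have hh : ∀ i, invS c i ∈ shHomog (-1) := by
    intro i
    refine ⟨1, 1, MvPolynomial.X (i, 0) * MvPolynomial.C (c 0)
      + MvPolynomial.X (i, 1) * MvPolynomial.C (c 1), ?_, by norm_num, ?_⟩
    · exact ((MvPolynomial.isHomogeneous_X ℂ (i, 0)).mul (MvPolynomial.isHomogeneous_C _ _)).add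
        ((MvPolynomial.isHomogeneous_X ℂ (i, 1)).mul (MvPolynomial.isHomogeneous_C _ _))
    · have h : N * invS c i = Z.mulVec (constS c) i := congrFun (N_smul_invS c) i
      rw [pow_one, mul_comm, h]
      simp only [Matrix.mulVec, dotProduct, Fin.sum_univ_two, map_add, map_mul, constS_apply,
        ← MvPolynomial.algebraMap_eq, ← IsScalarTower.algebraMap_apply]
      rfl
  rw [mem_Udeg_iff]
  refine ⟨?_, hh⟩
  have hN := N_smul_invS c
  have hl : N • lap2 (invS c) = -invS c := by
    ext i
    have h1 : lap (N * invS c i) = 0 := by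
      rw [show N * invS c i = Z.mulVec (constS c) i from congrFun hN i]
      simp only [Matrix.mulVec, dotProduct, Fin.sum_univ_two, lap_apply, constS_apply, map_add,
        Derivation.leibniz, partialD_algebraMap, smul_eq_mul, mul_zero, zero_add]
      simp [partialD_Z, apply_ite, -Fin.isValue]
    rw [lap_N_mul, euler_of_mem (hh i)] at h1
    rw [Pi.smul_apply, Pi.neg_apply, smul_eq_mul, lap2_apply]
    push_cast at h1
    linear_combination h1
  have hd : diracL (Z.mulVec (constS c)) = (2 : ℂ) • constS c := by
    ext i
    rw [Pi.smul_apply, Algebra.smul_def, map_ofNat]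
    simp only [Matrix.mulVec, dotProduct, Fin.sum_univ_two, diracL_apply, constS_apply, map_add,
        Derivation.leibniz, partialD_algebraMap, smul_eq_mul, mul_zero, zero_add]
    obtain rfl | rfl : i = 0 ∨ i = 1 := by omega
    all_goals
      simp [partialD_Z, -Fin.isValue]
      ring
  have h1 := diracL_N_smul (invS c)
  have h2 := diracL_N_smul (lap2 (invS c))
  rw [hN, hd] at h1
  rw [hl, map_neg] at h2
  have f0 : N * invS c 0 = Z 0 0 * constS c 0 + Z 0 1 * constS c 1 := by
    have := congrFun hN 0
    simpa [Matrix.mulVec, dotProduct] using this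
  have f1 : N * invS c 1 = Z 1 0 * constS c 0 + Z 1 1 * constS c 1 := by
    have := congrFun hN 1
    simpa [Matrix.mulVec, dotProduct] using this
  have g0 : N * lap (invS c 0) = -invS c 0 := congrFun hl 0
  have g1 : N * lap (invS c 1) = -invS c 1 := congrFun hl 1
  have p0 : (2 : ℂ) • constS c 0 = N * diracL (invS c) 0
    + (Z 1 1 * invS c 0 - Z 0 1 * invS c 1) := congrFun h1 0
  have p1 : (2 : ℂ) • constS c 1 = N * diracL (invS c) 1
    + (Z 0 0 * invS c 1 - Z 1 0 * invS c 0) := congrFun h1 1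
  have q0 : -diracL (invS c) 0 = N * diracL (lap2 (invS c)) 0
    + (Z 1 1 * lap (invS c 0) - Z 0 1 * lap (invS c 1)) := congrFun h2 0
  have q1 : -diracL (invS c) 1 = N * diracL (lap2 (invS c)) 1
    + (Z 0 0 * lap (invS c 1) - Z 1 0 * lap (invS c 0)) := congrFun h2 1
  rw [Algebra.smul_def, map_ofNat] at p0 p1
  have r0 : Z 1 1 * invS c 0 - Z 0 1 * invS c 1 = constS c 0 := by
    apply isUnit_N.mul_left_cancel
    conv_rhs => rw [N_eq]
    linear_combination Z 1 1 * f0 - Z 0 1 * f1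
  have r1 : Z 0 0 * invS c 1 - Z 1 0 * invS c 0 = constS c 1 := by
    apply isUnit_N.mul_left_cancel
    conv_rhs => rw [N_eq]
    linear_combination Z 0 0 * f1 - Z 1 0 * f0
  ext i
  apply (isUnit_N.mul isUnit_N).mul_left_cancel
  rw [Pi.zero_apply, mul_zero]
  obtain rfl | rfl : i = 0 ∨ i = 1 := by omega
  · linear_combination -N * q0 + p0 - Z 1 1 * g0 + Z 0 1 * g1 + 2 * r0
  · linear_combination -N * q1 + p1 - Z 0 0 * g1 + Z 1 0 * g0 + 2 * r1

/-! ### Invariance of `𝒰⁺` and `𝒰⁻` -/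

/-- Serves both halves: a set of degrees gives an invariant sum when each block shifting the degree
either stays in the set or kills the component it would move out. -/
theorem opL_mem_iSup_Udeg {P : ℤ → Prop} (X : GLHC)
    (hB : ∀ d, P d → P (d - 1) ∨ ∀ f ∈ Udeg d, opL !![0, X 0 1; 0, 0] f = 0)
    (hC : ∀ d, P d → P (d + 1) ∨ ∀ f ∈ Udeg d, opL !![0, 0; X 1 0, 0] f = 0) {f : ShS}
    (hf : f ∈ ⨆ (d : ℤ) (_ : P d), Udeg d) : opL X f ∈ ⨆ (d : ℤ) (_ : P d), Udeg d := by
  have hle : ∀ d, P d → Udeg d ≤ ⨆ (d : ℤ) (_ : P d), Udeg d := fun d hd =>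
    le_iSup₂_of_le d hd le_rfl
  suffices h : ⨆ (d : ℤ) (_ : P d), Udeg d ≤ (⨆ (d : ℤ) (_ : P d), Udeg d).comap (opL X) from h hf
  refine iSup₂_le fun d hd g hg => ?_
  rw [Submodule.mem_comap, opL_blocks]
  refine add_mem (add_mem (add_mem ?_ ?_) ?_) ?_
  · exact hle d hd ⟨opL_mem_U _ hg.1, opL_left_mem_homog _ hg.2⟩
  · rcases hB d hd with h | h
    · exact hle _ h ⟨opL_mem_U _ hg.1, opL_translation_mem_homog _ hg.2 rfl⟩
    · rw [h g hg]
      exact zero_mem _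
  · rcases hC d hd with h | h
    · exact hle _ h ⟨opL_mem_U _ hg.1, opL_special_mem_homog _ hg.2 rfl⟩
    · rw [h g hg]
      exact zero_mem _
  · exact hle d hd ⟨opL_mem_U _ hg.1, opL_right_mem_homog _ hg.2⟩

theorem opL_mem_Uplus (X : GLHC) {f : ShS} (hf : f ∈ Uplus) : opL X f ∈ Uplus := by
  refine opL_mem_iSup_Udeg X (fun d hd => ?_) (fun d hd => Or.inl (by omega)) hf
  obtain rfl | h : d = 0 ∨ 0 ≤ d - 1 := by omega
  · refine Or.inr fun g hg => ?_
    obtain ⟨c, rfl⟩ := mem_Udeg_zero hg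
    exact opL_translation_constS _ c
  · exact Or.inl h

theorem opL_mem_Uminus (X : GLHC) {f : ShS} (hf : f ∈ Uminus) : opL X f ∈ Uminus := by
  refine opL_mem_iSup_Udeg X (fun d hd => Or.inl (by omega)) (fun d hd => ?_) hf
  obtain rfl | h : d = -1 ∨ d + 1 < 0 := by omega
  · refine Or.inr fun g hg => ?_
    obtain ⟨c, rfl⟩ := mem_Udeg_neg_one hg
    exact opL_special_invS _ c
  · exact Or.inl h

/-! ### Invariant subspaces -/

/-- A subspace that is invariant under an endomorphism contains the components of its elements
along distinct eigenspaces. -/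
theorem mem_of_sum_eigenvectors_mem {ι V : Type*} [AddCommGroup V] [Module ℂ V]
    {T : Module.End ℂ V} {μ : ι → ℂ} (hμ : Function.Injective μ) {W : Submodule ℂ V}
    (hW : ∀ w ∈ W, T w ∈ W) (s : Finset ι) : ∀ v : ι → V, (∀ i, T (v i) = μ i • v i) →
      ∑ i ∈ s, v i ∈ W → ∀ i ∈ s, v i ∈ W := by
  classical
  induction s using Finset.induction_on with
  | empty => simp
  | insert a s ha ih =>
    intro v hv hs
    rw [Finset.sum_insert ha] at hs
    -- Applying `T - μ a` removes the term of index `a` and rescales the others by nonzero factors.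
    have h1 : ∑ i ∈ s, (μ i - μ a) • v i ∈ W := by
      have h2 := sub_mem (hW _ hs) (W.smul_mem (μ a) hs)
      rw [map_add, map_sum, hv, smul_add, add_sub_add_left_eq_sub, Finset.smul_sum,
        ← Finset.sum_sub_distrib] at h2
      simpa only [hv, ← sub_smul] using h2
    have h3 : ∀ i ∈ s, v i ∈ W := by
      intro i hi
      have h4 := ih (fun i => (μ i - μ a) • v i)
        (fun i => by rw [map_smul, hv, smul_comm]) h1 i hi
      have h5 : μ i - μ a ≠ 0 := by
        rw [sub_ne_zero]
        intro h
        rw [hμ h] at hi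
        exact ha hi
      exact (W.smul_mem_iff h5).mp h4
    intro i hi
    rcases Finset.mem_insert.mp hi with rfl | hi
    · exact (W.add_mem_iff_left (sum_mem h3)).mp hs
    · exact h3 i hi

/-- The vector field is twice the Euler field and the multiplier is `-1 + 2 = 1`. The eigenvalues
separate all degrees, and the element lies in `sl(2, HC)`. -/
theorem opL_grading {d : ℤ} {f : ShS} (hf : f ∈ homog d) :
    opL !![-1, 0; 0, 1] f = (2 * d + 1 : ℂ) • f := by
  rw [mem_homog_iff] at hf
  ext i
  have h := euler_of_mem (hf i)
  have hfield : field !![-1, 0; 0, 1] = Z + Z := by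
    ext i j
    simp [field, const, Matrix.mul_apply, Matrix.one_apply]
  rw [opL_apply, hfield, trPartial_add, Derivation.add_apply]
  change euler _ + euler _ + _ = _
  rw [h, Pi.smul_apply, Algebra.smul_def]
  simp only [map_add, map_mul, map_intCast, map_ofNat, map_one]
  obtain rfl | rfl : i = 0 ∨ i = 1 := by omega
  all_goals
    simp [quotL, const_apply, const_zero]
    ring

/-- Invariance under the operators in `sl(2, HC)` that the proof of irreducibility uses. -/
structure IsStable (W : Submodule ℂ ShS) : Prop where
  grading : ∀ f ∈ W, opL !![-1, 0; 0, 1] f ∈ W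
  lowering : ∀ i j, ∀ f ∈ W, partialD2 i j f ∈ W
  raising : ∀ i j, ∀ f ∈ W, special i j f ∈ W
  left : ∀ i j, i ≠ j → ∀ f ∈ W, opL !![Matrix.single i j 1, 0; 0, 0] f ∈ W
  right : ∀ i j, i ≠ j → ∀ f ∈ W, opL !![0, 0; 0, Matrix.single i j 1] f ∈ W

theorem IsStable.of_slHC {W : Submodule ℂ ShS}
    (h : ∀ X : slHC, ∀ f ∈ W, opL X f ∈ W) : IsStable W where
  grading := h ⟨!![-1, 0; 0, 1], by
    change Matrix.trace _ + Matrix.trace _ = 0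
    simp⟩
  lowering i j f hf := by
    rw [partialD2_eq]
    exact neg_mem (h ⟨!![0, Matrix.single i j 1; 0, 0], by
      change Matrix.trace _ + Matrix.trace _ = 0
      simp⟩ f hf)
  raising i j := h ⟨!![0, 0; Matrix.single i j 1, 0], by
    change Matrix.trace _ + Matrix.trace _ = 0
    simp⟩
  left i j hij := h ⟨!![Matrix.single i j 1, 0; 0, 0], by
    change Matrix.trace _ + Matrix.trace _ = 0
    simp [Matrix.trace_single_eq_of_ne _ _ _ hij]⟩
  right i j hij := h ⟨!![0, 0; 0, Matrix.single i j 1], by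
    change Matrix.trace _ + Matrix.trace _ = 0
    simp [Matrix.trace_single_eq_of_ne _ _ _ hij]⟩

theorem IsStable.exists_homogeneous {W : Submodule ℂ ShS} (hW : IsStable W) {P : ℤ → Prop}
    (hle : W ≤ ⨆ (d : ℤ) (_ : P d), Udeg d) (h0 : W ≠ ⊥) :
    ∃ d, P d ∧ ∃ f ∈ W, f ∈ Udeg d ∧ f ≠ 0 := by
  obtain ⟨f, hf, hne⟩ := W.exists_mem_ne_zero_of_ne_bot h0
  obtain ⟨v, hv, hs⟩ := (Submodule.mem_iSup_iff_exists_finsupp _ _).mp (hle hf)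
  have hP : ∀ d, v d ≠ 0 → P d ∧ v d ∈ Udeg d := by
    intro d hd
    have h1 := hv d
    by_cases h : P d
    · simp only [h, iSup_pos] at h1
      exact ⟨h, h1⟩
    · simp only [h, iSup_neg, not_false_eq_true, Submodule.mem_bot] at h1
      exact absurd h1 hd
  have hinj : Function.Injective fun d : ℤ => (2 * d + 1 : ℂ) := by
    intro a b h
    have h' : (2 * a + 1 : ℤ) = 2 * b + 1 := by
      have h2 : (2 * a + 1 : ℂ) = 2 * b + 1 := h
      exact_mod_cast h2
    omega
  have hmem := mem_of_sum_eigenvectors_mem hinj hW.grading v.support v (fun d => by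
    by_cases hd : v d = 0
    · rw [hd, map_zero, smul_zero]
    · exact opL_grading (hP d hd).2.2) (by
    rw [Finsupp.sum] at hs
    rw [hs]
    exact hf)
  obtain ⟨d, hd⟩ : v.support.Nonempty := by
    by_contra h
    rw [Finset.not_nonempty_iff_eq_empty, Finsupp.support_eq_empty] at h
    rw [h, Finsupp.sum_zero_index] at hs
    exact hne hs.symm
  have hd' := Finsupp.mem_support_iff.mp hd
  exact ⟨d, (hP d hd').1, v d, hmem d hd, (hP d hd').2, hd'⟩

/-- `ℂ²` is irreducible under the elementary matrices `E₁₂` and `E₂₁`. -/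
theorem eq_top_of_mulVec_single {W : Submodule ℂ (Fin 2 → ℂ)}
    (hW : ∀ i j : Fin 2, i ≠ j → ∀ c ∈ W, (Matrix.single i j (1 : ℂ)).mulVec c ∈ W)
    {c : Fin 2 → ℂ} (hc : c ∈ W) (h0 : c ≠ 0) : W = ⊤ := by
  have h1 : ∀ i j : Fin 2, i ≠ j → ∀ b ∈ W, Pi.single i (b j) ∈ W := by
    intro i j hij b hb
    have h := hW i j hij b hb
    rwa [Matrix.single_mulVec, one_mul] at h
  have h2 : ∃ j, c j ≠ 0 := by
    by_contra! h
    exact h0 (funext h)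
  obtain ⟨j, hj⟩ := h2
  -- If `c j ≠ 0`, then `E_ij` gives `c j` times the `i`-th basis vector, and `E_ji` carries it to
  -- `c j` times the `j`-th.
  obtain ⟨i, hij⟩ : ∃ i : Fin 2, i ≠ j := exists_ne j
  have h3 := h1 i j hij c hc
  have h4 := h1 j i hij.symm _ h3
  rw [Pi.single_eq_same] at h4
  rw [eq_top_iff]
  intro b _
  have h5 : b = (b i / c j) • Pi.single i (c j) + (b j / c j) • Pi.single j (c j) := by
    ext k
    have hk : k = i ∨ k = j := by omega
    rcases hk with rfl | rfl
    · simp [hj, hij]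
    · simp [hj, hij.symm]
  rw [h5]
  exact add_mem (W.smul_mem _ h3) (W.smul_mem _ h4)

theorem opL_left_constS (A : HC) (hA : A.trace = 0) (c : Fin 2 → ℂ) :
    opL !![A, 0; 0, 0] (constS c) = constS (A.mulVec c) := by
  have h : algebraMap ℂ Sh (A 0 0) + algebraMap ℂ Sh (A 1 1) = 0 := by
    rw [← map_add, ← Matrix.trace_fin_two, hA, map_zero]
  ext i
  rw [opL_left, trPartial_apply]
  simp only [constS_apply, partialD_algebraMap, const_apply, h, Matrix.mulVec, dotProduct,
    Fin.sum_univ_two, map_add, map_mul]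
  ring

/-- The field `tr(ZD ∂)` sends `Z` to `Z D` and `N` to `tr(D) N`, so for traceless `D` it acts only
on the constant factor `c` of `N⁻¹ Z c`. -/
theorem opL_right_invS (D : HC) (hD : D.trace = 0) (c : Fin 2 → ℂ) :
    opL !![0, 0; 0, D] (invS c) = invS (D.mulVec c) := by
  have h : algebraMap ℂ Sh (D 0 0) + algebraMap ℂ Sh (D 1 1) = 0 := by
    rw [← map_add, ← Matrix.trace_fin_two, hD, map_zero]
  apply N_smul_cancel
  rw [N_smul_invS]
  ext k
  have hk : N * invS c k = Z.mulVec (constS c) k := congrFun (N_smul_invS c) k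
  have e1 := N_mul_partialD_invS c 0 0 k
  have e2 := N_mul_partialD_invS c 0 1 k
  have e3 := N_mul_partialD_invS c 1 0 k
  have e4 := N_mul_partialD_invS c 1 1 k
  rw [Pi.smul_apply, smul_eq_mul, opL_right, trPartial_apply]
  simp only [Matrix.mulVec, dotProduct, Fin.sum_univ_two, map_add, Derivation.leibniz,
    smul_eq_mul, mul_zero, zero_add, constS_apply, partialD_algebraMap, Matrix.mul_apply,
    const_apply, map_mul] at hk e1 e2 e3 e4 ⊢
  rw [N_eq] at *
  simp only [map_sub, Derivation.leibniz, smul_eq_mul] at e1 e2 e3 e4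
  obtain rfl | rfl : k = 0 ∨ k = 1 := by omega
  all_goals simp [partialD_Z, -Fin.isValue] at e1 e2 e3 e4
  · linear_combination (Z 0 0 * algebraMap ℂ Sh (D 0 0) + Z 0 1 * algebraMap ℂ Sh (D 1 0)) * e1
      + (Z 0 0 * algebraMap ℂ Sh (D 0 1) + Z 0 1 * algebraMap ℂ Sh (D 1 1)) * e2
      + (Z 1 0 * algebraMap ℂ Sh (D 0 0) + Z 1 1 * algebraMap ℂ Sh (D 1 0)) * e3
      + (Z 1 0 * algebraMap ℂ Sh (D 0 1) + Z 1 1 * algebraMap ℂ Sh (D 1 1)) * e4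
      - (Z 0 0 * Z 1 1 - Z 0 1 * Z 1 0) * invS c 0 * h
  · linear_combination (Z 0 0 * algebraMap ℂ Sh (D 0 0) + Z 0 1 * algebraMap ℂ Sh (D 1 0)) * e1
      + (Z 0 0 * algebraMap ℂ Sh (D 0 1) + Z 0 1 * algebraMap ℂ Sh (D 1 1)) * e2
      + (Z 1 0 * algebraMap ℂ Sh (D 0 0) + Z 1 1 * algebraMap ℂ Sh (D 1 0)) * e3
      + (Z 1 0 * algebraMap ℂ Sh (D 0 1) + Z 1 1 * algebraMap ℂ Sh (D 1 1)) * e4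
      - (Z 0 0 * Z 1 1 - Z 0 1 * Z 1 0) * invS c 1 * h

theorem invS_add (b c : Fin 2 → ℂ) : invS (b + c) = invS b + invS c := by
  simp only [invS, map_add, Matrix.mulVec_add, smul_add]

theorem invS_smul (a : ℂ) (c : Fin 2 → ℂ) : invS (a • c) = a • invS c := by
  rw [invS, map_smul, Matrix.mulVec_smul, smul_comm, invS]

/-- `invS` as a linear map. -/
def invSHom : (Fin 2 → ℂ) →ₗ[ℂ] ShS where
  toFun := invS
  map_add' := invS_add
  map_smul' := invS_smul

theorem IsStable.Udeg_zero_le {W : Submodule ℂ ShS} (hW : IsStable W) {f : ShS} (hf : f ∈ W)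
    (hf0 : f ∈ Udeg 0) (hne : f ≠ 0) : Udeg 0 ≤ W := by
  obtain ⟨c, rfl⟩ := mem_Udeg_zero hf0
  have h : W.comap constS = ⊤ := by
    refine eq_top_of_mulVec_single (c := c) (fun i j hij b hb => ?_) hf ?_
    · have h := hW.left i j hij _ hb
      rwa [opL_left_constS _ (Matrix.trace_single_eq_of_ne _ _ _ hij)] at h
    · rintro rfl
      exact hne (map_zero _)
  intro g hg
  obtain ⟨b, rfl⟩ := mem_Udeg_zero hg
  exact (h ▸ Submodule.mem_top : b ∈ W.comap constS)

theorem IsStable.Udeg_neg_one_le {W : Submodule ℂ ShS} (hW : IsStable W) {f : ShS} (hf : f ∈ W)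
    (hf0 : f ∈ Udeg (-1)) (hne : f ≠ 0) : Udeg (-1) ≤ W := by
  obtain ⟨c, rfl⟩ := mem_Udeg_neg_one hf0
  have h : W.comap invSHom = ⊤ := by
    refine eq_top_of_mulVec_single (c := c) (fun i j hij b hb => ?_) hf ?_
    · have h := hW.right i j hij (invS b) hb
      rwa [opL_right_invS _ (Matrix.trace_single_eq_of_ne _ _ _ hij)] at h
    · rintro rfl
      exact hne (map_zero invSHom)
  intro g hg
  obtain ⟨b, rfl⟩ := mem_Udeg_neg_one hg
  exact (h ▸ Submodule.mem_top : b ∈ W.comap invSHom)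

/-! ### Descent to the extremal degree and ascent from it -/

theorem partialD2_mem_Udeg (i j : Fin 2) {d d' : ℤ} {f : ShS} (hf : f ∈ Udeg d)
    (hd : d' = d - 1) : partialD2 i j f ∈ Udeg d' := by
  rw [partialD2_eq]
  exact neg_mem ⟨opL_mem_U _ hf.1, opL_translation_mem_homog _ hf.2 hd⟩

theorem special_mem_Udeg (i j : Fin 2) {d d' : ℤ} {f : ShS} (hf : f ∈ Udeg d)
    (hd : d' = d + 1) : special i j f ∈ Udeg d' :=
  ⟨opL_mem_U _ hf.1, opL_special_mem_homog _ hf.2 hd⟩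

theorem IsStable.eq_Uplus {W : Submodule ℂ ShS} (hW : IsStable W) (hle : W ≤ Uplus)
    (h0 : W ≠ ⊥) : W = Uplus := by
  obtain ⟨d, hd, f, hf, hfd, hne⟩ := hW.exists_homogeneous hle h0
  -- Descent: in positive degree some partial derivative of a nonzero element is nonzero.
  have hbase : ∀ n : ℕ, ∀ f ∈ W, f ∈ Udeg n → f ≠ 0 → Udeg 0 ≤ W := by
    intro n
    induction n with
    | zero => exact fun f hf hf0 hne => hW.Udeg_zero_le hf hf0 hne
    | succ n ih =>
      intro f hf hfd hne
      have h : ∃ i j, partialD2 i j f ≠ 0 := by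
        by_contra! h
        exact hne (eq_zero_of_partialD (by omega) hfd h)
      obtain ⟨i, j, h⟩ := h
      exact ih _ (hW.lowering i j f hf)
        (partialD2_mem_Udeg i j hfd (by push_cast; ring)) h
  -- Ascent: each `special i j (partialD2 j i g)` comes from the preceding degree, and these images
  -- recover `g` by the nonzero eigenvalues.
  have hall : ∀ n : ℕ, Udeg n ≤ W := by
    intro n
    induction n with
    | zero =>
      refine hbase d.toNat f hf ?_ hne
      rwa [Int.toNat_of_nonneg hd]
    | succ n ih =>
      refine Udeg_le_of_partialD (by omega) fun g hg i j => ?_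
      exact hW.raising i j _ (ih (partialD2_mem_Udeg j i hg (by push_cast; ring)))
  refine le_antisymm hle (iSup₂_le fun e he => ?_)
  have := hall e.toNat
  rwa [Int.toNat_of_nonneg he] at this

theorem IsStable.eq_Uminus {W : Submodule ℂ ShS} (hW : IsStable W) (hle : W ≤ Uminus)
    (h0 : W ≠ ⊥) : W = Uminus := by
  obtain ⟨d, hd, f, hf, hfd, hne⟩ := hW.exists_homogeneous hle h0
  -- Negative degrees are written `-1 - n`, so that induction on `n` starts at the extremal degree
  -- `-1`, reached by raising.
  have hbase : ∀ n : ℕ, ∀ f ∈ W, f ∈ Udeg (-1 - n) → f ≠ 0 → Udeg (-1) ≤ W := by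
    intro n
    induction n with
    | zero => exact fun f hf hf0 hne => hW.Udeg_neg_one_le hf (by simpa using hf0) hne
    | succ n ih =>
      intro f hf hfd hne
      have h : ∃ i j, special i j f ≠ 0 := by
        by_contra! h
        exact hne (eq_zero_of_special (by push_cast; omega) hfd h)
      obtain ⟨i, j, h⟩ := h
      exact ih _ (hW.raising i j f hf) (special_mem_Udeg i j hfd (by push_cast; ring)) h
  have hall : ∀ n : ℕ, Udeg (-1 - n) ≤ W := by
    intro n
    induction n with
    | zero =>
      have h := hbase (-1 - d).toNat f hf (by
        rw [Int.toNat_of_nonneg (by omega)]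
        convert hfd using 2
        ring) hne
      simpa using h
    | succ n ih =>
      refine Udeg_le_of_special (by push_cast; omega) fun g hg i j => ?_
      exact hW.lowering j i _ (ih (special_mem_Udeg i j hg (by push_cast; ring)))
  refine le_antisymm hle (iSup₂_le fun e he => ?_)
  have := hall (-1 - e).toNat
  rw [Int.toNat_of_nonneg (by omega)] at this
  convert this using 2
  ring

/-! ### Nonvanishing of the two halves, and passage from `sl` to `gl` -/

theorem exists_ringHom_eval_one : ∃ φ : Sh →+* ℂ, ∀ i j, φ (Z i j) = (1 : HC) i j := by
  have h1 : (1 : HC).det ≠ 0 := by simp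
  obtain ⟨φ, hφ, -⟩ := evalSh_eq h1
  exact ⟨φ, fun i j => by rw [← hφ, evalSh_Z h1]⟩

theorem Uplus_ne_bot : Uplus ≠ ⊥ := by
  intro h
  have h1 : constS 1 ∈ Uplus := le_iSup₂_of_le (f := fun (d : ℤ) (_ : 0 ≤ d) => Udeg d) 0 le_rfl
    le_rfl (constS_mem 1)
  rw [h, Submodule.mem_bot] at h1
  obtain ⟨φ, -⟩ := exists_ringHom_eval_one
  have h2 := congrArg φ (congrFun h1 0)
  simp [constS_apply] at h2

theorem Uminus_ne_bot : Uminus ≠ ⊥ := by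
  intro h
  have h1 : invS 1 ∈ Uminus := le_iSup₂_of_le (f := fun (d : ℤ) (_ : d < 0) => Udeg d) (-1)
    (by norm_num) le_rfl (invS_mem 1)
  rw [h, Submodule.mem_bot] at h1
  obtain ⟨φ, hφ⟩ := exists_ringHom_eval_one
  have h2 := N_smul_invS 1
  rw [h1, smul_zero] at h2
  have h3 := congrArg φ (congrFun h2 0)
  simp [Matrix.mulVec, dotProduct, constS_apply, hφ] at h3

/-- A `gl`-invariant subspace is `sl`-invariant, so invariance has to be checked for `gl` and
minimality only for `sl`. -/
theorem isIrreducibleOn_of_isStable {ρ : GLHC →ₗ⁅ℂ⁆ Module.End ℂ ShS} {V : Submodule ℂ ShS}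
    (hinv : ∀ X, ∀ f ∈ V, ρ X f ∈ V) (hne : V ≠ ⊥)
    (hirr : ∀ W ≤ V, (∀ X : slHC, ∀ f ∈ W, ρ X f ∈ W) → W ≠ ⊥ → W = V) :
    IsIrreducibleOn (ρ.comp slHC.incl) V ∧ IsIrreducibleOn ρ V := by
  refine ⟨⟨fun X => hinv X, hne, fun W hle hW => ?_⟩, ⟨hinv, hne, fun W hle hW => ?_⟩⟩
  · rw [or_iff_not_imp_left]
    exact hirr W hle hW
  · rw [or_iff_not_imp_left]
    exact hirr W hle fun X => hW X

theorem isIrreducibleOn_Uplus : IsIrreducibleOn (piL.comp slHC.incl) Uplus ∧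
    IsIrreducibleOn piL Uplus :=
  isIrreducibleOn_of_isStable (fun X _ => opL_mem_Uplus X) Uplus_ne_bot
    fun _ hle hW => (IsStable.of_slHC hW).eq_Uplus hle

theorem isIrreducibleOn_Uminus : IsIrreducibleOn (piL.comp slHC.incl) Uminus ∧
    IsIrreducibleOn piL Uminus :=
  isIrreducibleOn_of_isStable (fun X _ => opL_mem_Uminus X) Uminus_ne_bot
    fun _ hle hW => (IsStable.of_slHC hW).eq_Uminus hle

/-! ### Transposition -/

/-- The substitution `Z ↦ Zᵀ` on polynomials, with values in `Sh`. -/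
def polyTr : Poly →ₐ[ℂ] Sh := MvPolynomial.aeval fun p => Z p.2 p.1

theorem polyTr_eq (p : Poly) :
    polyTr p = algebraMap Poly Sh (MvPolynomial.rename Prod.swap p) := by
  induction p using MvPolynomial.induction_on with
  | C a =>
    rw [MvPolynomial.rename_C, polyTr, MvPolynomial.aeval_C, ← MvPolynomial.algebraMap_eq,
      ← IsScalarTower.algebraMap_apply]
  | add p q hp hq => simp only [map_add, hp, hq]
  | mul_X p k hp =>
    rw [map_mul, map_mul, map_mul, hp, MvPolynomial.rename_X]
    congr 1
    exact MvPolynomial.aeval_X _ _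

theorem polyTr_polyN : polyTr polyN = N := by
  simp only [polyN, Matrix.det_fin_two, map_sub, map_mul, polyZ, Matrix.of_apply, polyTr,
    MvPolynomial.aeval_X, N_eq]
  ring

theorem isUnit_polyTr : IsUnit (polyTr polyN) := by
  rw [polyTr_polyN]
  exact isUnit_N

/-- The substitution `Z ↦ Zᵀ`. -/
def tr : Sh →ₐ[ℂ] Sh := IsLocalization.Away.liftAlgHom polyN isUnit_polyTr

theorem tr_algebraMap (p : Poly) :
    tr (algebraMap Poly Sh p) = algebraMap Poly Sh (MvPolynomial.rename Prod.swap p) := by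
  rw [← polyTr_eq]
  simp [tr]

theorem tr_Z (i j : Fin 2) : tr (Z i j) = Z j i := by
  have h : Z i j = algebraMap Poly Sh (MvPolynomial.X (i, j)) := rfl
  rw [h, tr_algebraMap, MvPolynomial.rename_X]
  rfl

theorem tr_N : tr N = N := by
  rw [N_eq, map_sub, map_mul, map_mul, tr_Z, tr_Z, tr_Z, tr_Z]
  ring

theorem tr_tr (f : Sh) : tr (tr f) = f := by
  have h : tr.comp tr = AlgHom.id ℂ Sh := by
    apply IsLocalization.algHom_ext (Submonoid.powers polyN)
    apply MvPolynomial.algHom_ext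
    rintro ⟨i, j⟩
    change tr (tr (Z i j)) = Z i j
    rw [tr_Z, tr_Z]
  exact DFunLike.congr_fun h f

/-- Conjugating a derivation by the involution `tr` gives a derivation, which is identified by its
values on the coordinates. -/
theorem partialD_tr (i j : Fin 2) (f : Sh) : partialD i j (tr f) = tr (partialD j i f) := by
  let E : Derivation ℂ Sh Sh := Derivation.mk'
    (tr.toLinearMap ∘ₗ (partialD i j : Sh →ₗ[ℂ] Sh) ∘ₗ tr.toLinearMap) (by
      intro a b
      simp only [LinearMap.comp_apply, AlgHom.toLinearMap_apply, map_mul, Derivation.coeFn_coe,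
        Derivation.leibniz, smul_eq_mul, map_add, tr_tr])
  have hE : ∀ f, E f = tr (partialD i j (tr f)) := fun f => rfl
  have h : E = partialD j i := by
    apply sh_derivation_ext
    intro k l
    rw [hE, tr_Z, partialD_Z, partialD_Z, apply_ite tr, map_one, map_zero]
    simp only [and_comm]
  rw [← h, hE, tr_tr]

theorem lap_tr (f : Sh) : lap (tr f) = tr (lap f) := by
  rw [lap_apply, lap_apply, partialD_tr, partialD_tr, partialD_tr, partialD_tr, map_sub,
    partialD_comm 1 0 0 1]

theorem tr_mem_shHomog {d : ℤ} {f : Sh} (hf : f ∈ shHomog d) : tr f ∈ shHomog d := by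
  obtain ⟨n, k, p, hp, hn, h⟩ := hf
  refine ⟨n, k, MvPolynomial.rename Prod.swap p, hp.rename_isHomogeneous, hn, ?_⟩
  rw [← tr_algebraMap, ← h, map_mul, map_pow, tr_N]

/-- The substitution `Z ↦ Zᵀ` on pairs, which exchanges rows and columns. -/
def tr2 : ShS ≃ₗ[ℂ] ShS :=
  LinearEquiv.ofInvolutive (compwise tr.toLinearMap) fun f => funext fun i => tr_tr (f i)

theorem tr2_apply (f : ShS) (i : Fin 2) : tr2 f i = tr (f i) := rfl

theorem tr2_tr2 (f : ShS) : tr2 (tr2 f) = f := funext fun i => tr_tr (f i)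

theorem tr2_mem_Udeg'_iff {d : ℤ} {f : ShS} : tr2 f ∈ Udeg' d ↔ f ∈ Udeg d := by
  have h1 : diracR (lap2 (tr2 f)) = tr2 (diracL (lap2 f)) := by
    ext i
    simp only [diracR_apply, diracL_apply, lap2_apply, tr2_apply, lap_tr, partialD_tr, map_add]
  have h2 : tr2 f ∈ homog d ↔ f ∈ homog d := by
    rw [mem_homog_iff, mem_homog_iff]
    refine forall_congr' fun i => ⟨fun h => ?_, tr_mem_shHomog⟩
    rw [← tr_tr (f i)]
    exact tr_mem_shHomog h
  rw [Udeg, Udeg', Submodule.mem_inf, Submodule.mem_inf, mem_U_iff, mem_U'_iff, h1, h2,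
    EmbeddingLike.map_eq_zero_iff]

theorem Udeg'_eq (d : ℤ) : Udeg' d = (Udeg d).map (tr2 : ShS →ₗ[ℂ] ShS) := by
  ext f
  rw [Submodule.mem_map]
  constructor
  · intro hf
    refine ⟨tr2 f, ?_, tr2_tr2 f⟩
    rwa [← tr2_mem_Udeg'_iff, tr2_tr2]
  · rintro ⟨g, hg, rfl⟩
    exact tr2_mem_Udeg'_iff.mpr hg

theorem Uplus'_eq : Uplus' = Uplus.map (tr2 : ShS →ₗ[ℂ] ShS) := by
  simp only [Uplus', Uplus, Submodule.map_iSup, Udeg'_eq]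

theorem Uminus'_eq : Uminus' = Uminus.map (tr2 : ShS →ₗ[ℂ] ShS) := by
  simp only [Uminus', Uminus, Submodule.map_iSup, Udeg'_eq]

/-- The automorphism of `gl(2, HC)` that corresponds to `Z ↦ Zᵀ`. -/
def trGL (X : GLHC) : GLHC :=
  !![-(X 1 1).transpose, (X 0 1).transpose; (X 1 0).transpose, -(X 0 0).transpose]

theorem trGL_trGL (X : GLHC) : trGL (trGL X) = X := by
  ext i j : 2
  fin_cases i <;> fin_cases j <;> simp [trGL]

theorem trGL_mem_slHC {X : GLHC} (hX : X ∈ slHC) : trGL X ∈ slHC := by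
  change Matrix.trace _ + Matrix.trace _ = 0
  change Matrix.trace _ + Matrix.trace _ = 0 at hX
  simp only [trGL, Matrix.of_apply, Matrix.cons_val', Matrix.cons_val_zero, Matrix.cons_val_one,
    Matrix.cons_val_fin_one, Matrix.trace_neg, Matrix.trace_transpose]
  linear_combination -hX

/-- Transposing `-AZ - B + ZCZ + ZD` exchanges the diagonal blocks with a sign and transposes `B`
and `C`. The same replacement turns `A - ZC` into the negative transpose of `CZ + D`, which matches
the multipliers. -/
theorem opR_tr2 (X : GLHC) (f : ShS) : opR X (tr2 f) = tr2 (opL (trGL X) f) := by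
  ext i
  have hc : ∀ c : ℂ, tr (algebraMap ℂ Sh c) = algebraMap ℂ Sh c := fun c => tr.commutes c
  rw [tr2_apply, opR_apply, opL_apply, trPartial_apply, trPartial_apply]
  simp only [tr2_apply, partialD_tr, map_add, map_sub, map_mul, field, quotL, quotR, trGL,
    Matrix.add_apply, Matrix.sub_apply, Matrix.neg_apply, Matrix.mul_apply, Fin.sum_univ_two,
    const_apply, map_neg, tr_Z, hc, Matrix.of_apply, Matrix.cons_val', Matrix.cons_val_zero,
    Matrix.cons_val_one, Matrix.cons_val_fin_one, Matrix.transpose_apply]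
  ring

theorem isIrreducibleOn_map_tr2 {V : Submodule ℂ ShS}
    (h : IsIrreducibleOn (piL.comp slHC.incl) V ∧ IsIrreducibleOn piL V) :
    IsIrreducibleOn (piR.comp slHC.incl) (V.map (tr2 : ShS →ₗ[ℂ] ShS)) ∧
      IsIrreducibleOn piR (V.map (tr2 : ShS →ₗ[ℂ] ShS)) := by
  obtain ⟨⟨-, hne, hirr⟩, ⟨hinv, -, -⟩⟩ := h
  refine isIrreducibleOn_of_isStable ?_ ?_ ?_
  · rintro X _ ⟨f, hf, rfl⟩
    exact ⟨_, hinv (trGL X) f hf, (opR_tr2 X f).symm⟩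
  · rwa [Ne, Submodule.map_eq_bot_iff]
  · intro W hle hW hW0
    have hstable : ∀ X : slHC, ∀ f ∈ W.comap (tr2 : ShS →ₗ[ℂ] ShS),
        (piL.comp slHC.incl) X f ∈ W.comap (tr2 : ShS →ₗ[ℂ] ShS) := by
      rintro ⟨X, hX⟩ f hf
      have h1 := hW ⟨trGL X, trGL_mem_slHC hX⟩ _ hf
      change opR (trGL X) (tr2 f) ∈ W at h1
      rwa [opR_tr2, trGL_trGL] at h1
    have hmap : (W.comap (tr2 : ShS →ₗ[ℂ] ShS)).map (tr2 : ShS →ₗ[ℂ] ShS) = W :=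
      Submodule.map_comap_eq_of_surjective tr2.surjective W
    have hle' : W.comap (tr2 : ShS →ₗ[ℂ] ShS) ≤ V := by
      intro f hf
      obtain ⟨g, hg, hgf⟩ := hle hf
      rwa [← tr2.injective hgf]
    rcases hirr _ hle' hstable with h0 | h0
    · rw [h0, Submodule.map_bot] at hmap
      exact absurd hmap.symm hW0
    · rw [← hmap, h0]

end

end QuasiRegular


theorem proposition4p7 :
    (QuasiRegular.IsIrreducibleOn (QuasiRegular.piL.comp QuasiRegular.slHC.incl)
        QuasiRegular.Uplus ∧
      QuasiRegular.IsIrreducibleOn QuasiRegular.piL QuasiRegular.Uplus) ∧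
    (QuasiRegular.IsIrreducibleOn (QuasiRegular.piL.comp QuasiRegular.slHC.incl)
        QuasiRegular.Uminus ∧
      QuasiRegular.IsIrreducibleOn QuasiRegular.piL QuasiRegular.Uminus) ∧
    (QuasiRegular.IsIrreducibleOn (QuasiRegular.piR.comp QuasiRegular.slHC.incl)
        QuasiRegular.Uplus' ∧
      QuasiRegular.IsIrreducibleOn QuasiRegular.piR QuasiRegular.Uplus') ∧
    (QuasiRegular.IsIrreducibleOn (QuasiRegular.piR.comp QuasiRegular.slHC.incl)
        QuasiRegular.Uminus' ∧
      QuasiRegular.IsIrreducibleOn QuasiRegular.piR QuasiRegular.Uminus') := by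
  rw [QuasiRegular.Uplus'_eq, QuasiRegular.Uminus'_eq]
  exact ⟨QuasiRegular.isIrreducibleOn_Uplus, QuasiRegular.isIrreducibleOn_Uminus,
    QuasiRegular.isIrreducibleOn_map_tr2 QuasiRegular.isIrreducibleOn_Uplus,
    QuasiRegular.isIrreducibleOn_map_tr2 QuasiRegular.isIrreducibleOn_Uminus⟩
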